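/- Let $p,q$ be integers with $p>q+1\geq 2$, and let $\mathbb R^{p,q}$ be $\mathbb R^{p+q}$ with standard basis $e_1,\dots,e_{p+q}$ and scalar product $\langle x,y\rangle=\sum_{i=1}^{p}x^iy^i-\sum_{j=1}^{q}x^{p+j}y^{p+j}$. Let $\Pi_i=\{x: x^{p-i+1}+x^{p+i}=0\}$ for $1\le i\le q$, and $\mathbb W^p=\bigcap_{i=1}^q\Pi_i$. Let $\mathfrak a\subset\mathfrak{so}(p,q)$ be the abelian subspace of the matrices $H_c=\sum_{i=1}^q c_i(E_{p-i+1,p+i}+E_{p+i,p-i+1})$, $c\in\mathbb R^q$, let $f_i\in\mathfrak a^*$ be given by $f_i(H_c)=-c_i$, and let $\mathfrak n$ be the sum of the root spaces $\{X\in\mathfrak{so}(p,q):[H,X]=\alpha(H)X\ \forall H\in\mathfrak a\}$ over the positive roots $\alpha=f_i\pm f_j$ $(i<j)$ and $\alpha=f_l$. Let $\mathbf A$ and $\mathbf N$ be the connected Lie subgroups with Lie algebras $\mathfrak a$ and $\mathfrak n$, and let $\mathbf K_0\cong SO(p-q)$ be the group of rotations of $\mathbb R^{p+q}$ fixing $e_{p-q+1},\dots,e_{p+q}$.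 For a subgroup $\mathbf K'\subseteq\mathbf K_0$ let $\mathbf K'\mathbf A\mathbf N$ act linearly on $\mathbb R^{p,q}$. Two groups acting on $\mathbb R^{p,q}$ are called orbit-equivalent on a subset $S$ if some isometry of $\mathbb R^{p,q}$ maps $S$ onto itself and maps the orbits of points of $S$ under the first group onto orbits of the second. An action is of cohomogeneity one if the largest dimension of an orbit is $p+q-1$; here the dimension of the orbit $G(x)$ is that of the space $\operatorname{span}\{Xx : \exp(tX)\in G\ \forall t\in\mathbb R\}$. Then: 1. $\mathbb W^p$ is a $p$-dimensional degenerate subspace of $\mathbb R^{p,q}$, that is, it contains a nonzero vector orthogonal to all of $\mathbb W^p$. 2. For every subgroup $\mathbf K'\subseteq\mathbf K_0$, the action of $\mathbf K'\mathbf A\mathbf N$ on $\mathbb R^{p,q}$ is isometric, of cohomogeneity one, and leaves $\mathbb W^p$ invariant; the group $\mathbf K'\mathbf A\mathbf N$ is closed if $\mathbf K'$ is. 3. For all subgroups $\mathbf K',\mathbf K''\subseteq\mathbf K_0$, the orbits of $\mathbf K'\mathbf A\mathbf N$ and of $\mathbf K''\mathbf A\mathbf N$ through each point of $\mathbb R^{p,q}\setminus\mathbb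 W^p$ coincide; in particular the two actions are orbit-equivalent on $\mathbb R^{p,q}\setminus\mathbb W^p$. Their orbits through each point of $\mathbb W^p$ coincide if and only if $\mathbf K'$ and $\mathbf K''$ have the same orbits. 4. There are closed subgroups $\mathbf K',\mathbf K''\subseteq\mathbf K_0$ such that the actions of $\mathbf K'\mathbf A\mathbf N$ and $\mathbf K''\mathbf A\mathbf N$ are not orbit-equivalent on $\mathbb W^p$; in fact no homeomorphism of $\mathbb W^p$ onto itself maps the orbits of one in $\mathbb W^p$ onto the orbits of the other. -/

import Mathlib

open scoped Matrix

noncomputable section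

namespace PseudoEuclid

/-- The vector space underlying `ℝ^{p,q}`: the coordinate `x^k` for `1 ≤ k ≤ p` is
`x (Sum.inl (k-1))`, and the coordinate `x^{p+j}` for `1 ≤ j ≤ q` is `x (Sum.inr (j-1))`. -/
abbrev Vec (p q : ℕ) : Type := Fin p ⊕ Fin q → ℝ

/-- Real square matrices of size `p + q`. -/
abbrev Mat (p q : ℕ) : Type := Matrix (Fin p ⊕ Fin q) (Fin p ⊕ Fin q) ℝ

/-- Invertible linear maps of `ℝ^{p,q}`, as invertible matrices. -/
abbrev GLpq (p q : ℕ) : Type := GL (Fin p ⊕ Fin q) ℝ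

/-- The scalar product of signature `(p,q)`. -/
def scalarProd {p q : ℕ} (x y : Vec p q) : ℝ :=
  ∑ i : Fin p, x (Sum.inl i) * y (Sum.inl i) - ∑ j : Fin q, x (Sum.inr j) * y (Sum.inr j)

/-- The position `p - i + 1` (counting from one), where `i` also counts from one: with indices
counted from zero this is `p - 1 - i`. -/
def mirror {p q : ℕ} (h : q ≤ p) (i : Fin q) : Fin p := Fin.rev (Fin.castLE h i)

/-- The degenerate hyperplane `Π_i`, given by `x^{p-i+1} + x^{p+i} = 0`. -/
def hyperplane {p q : ℕ} (h : q ≤ p) (i : Fin q) : Submodule ℝ (Vec p q) where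
  carrier := {x | x (Sum.inl (mirror h i)) + x (Sum.inr i) = 0}
  zero_mem' := by simp
  add_mem' := by
    intro x y hx hy
    simp only [Set.mem_ofPred_eq, Pi.add_apply] at *
    linarith
  smul_mem' := by
    intro c x hx
    simp only [Set.mem_ofPred_eq, Pi.smul_apply, smul_eq_mul] at *
    rw [← mul_add, hx, mul_zero]

/-- The subspace `W^p = ⋂ Π_i`. -/
def degSubspace {p q : ℕ} (h : q ≤ p) : Submodule ℝ (Vec p q) := ⨅ i : Fin q, hyperplane h i

/-! ### The factors of the Iwasawa decomposition -/

/-- The element of the maximal abelian subspace `𝔞` with parameters `c_1, …, c_q`: its upper right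
block has the entry `c_i` at the place `(p - i + 1, i)`, and zeros elsewhere. -/
def cartanElt {p q : ℕ} (h : q ≤ p) (c : Fin q → ℝ) : Mat p q :=
  let C : Matrix (Fin p) (Fin q) ℝ := Matrix.of fun k i => if k = mirror h i then c i else 0
  Matrix.fromBlocks 0 C Cᵀ 0

/-- The Lie algebra `𝔰𝔬(p,q)`, as a space of matrices: `X` is skew for the scalar product, whose
matrix is `J = diag(1, …, 1, -1, …, -1)`. -/
def soPQ (p q : ℕ) : Submodule ℝ (Mat p q) where
  carrier := {X | Xᵀ * LieAlgebra.Orthogonal.indefiniteDiagonal (Fin p) (Fin q) ℝ +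
    LieAlgebra.Orthogonal.indefiniteDiagonal (Fin p) (Fin q) ℝ * X = 0}
  zero_mem' := by simp
  add_mem' := by
    intro X Y hX hY
    simp only [Set.mem_ofPred_eq] at *
    rw [Matrix.transpose_add, add_mul, mul_add, add_add_add_comm, hX, hY, add_zero]
  smul_mem' := by
    intro r X hX
    simp only [Set.mem_ofPred_eq] at *
    rw [Matrix.transpose_smul, Matrix.smul_mul, Matrix.mul_smul, ← smul_add, hX, smul_zero]

/-- The space of `X ∈ 𝔰𝔬(p,q)` with `[H, X] = α(H) X` for all `H ∈ 𝔞`; functionals on `𝔞` are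
written in the parameters `c`. -/
def rootSpace {p q : ℕ} (h : q ≤ p) (α : Module.Dual ℝ (Fin q → ℝ)) :
    Submodule ℝ (Mat p q) where
  carrier := {X | X ∈ soPQ p q ∧
    ∀ c, cartanElt h c * X - X * cartanElt h c = α c • X}
  zero_mem' := ⟨zero_mem _, by simp⟩
  add_mem' := by
    rintro X Y ⟨hX, hX'⟩ ⟨hY, hY'⟩
    refine ⟨add_mem hX hY, fun c => ?_⟩
    rw [smul_add, ← hX' c, ← hY' c, mul_add, add_mul]
    abel
  smul_mem' := by
    rintro r X ⟨hX, hX'⟩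
    refine ⟨(soPQ p q).smul_mem r hX, fun c => ?_⟩
    rw [smul_comm, ← hX' c, Matrix.mul_smul, Matrix.smul_mul, smul_sub]

/-- The functional `f_i` on `𝔞`, with value `-c_i`. -/
def rootF {q : ℕ} (i : Fin q) : Module.Dual ℝ (Fin q → ℝ) := -LinearMap.proj i

/-- The nilpotent factor `𝔫`: the sum of the root spaces of the positive roots, which are
`f_i ± f_j` for `i < j`, and `f_l`. -/
def nilpotentPart {p q : ℕ} (h : q ≤ p) : Submodule ℝ (Mat p q) :=
  (⨆ l : Fin q, rootSpace h (rootF l)) ⊔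
    ⨆ (i : Fin q) (j : Fin q) (_ : i < j),
      rootSpace h (rootF i - rootF j) ⊔ rootSpace h (rootF i + rootF j)

/-- The connected Lie subgroup whose Lie algebra is the given one: it is generated by the
exponentials of the elements. -/
def expGroup {p q : ℕ} (s : Set (Mat p q)) : Subgroup (GLpq p q) :=
  Subgroup.closure {g | ∃ X ∈ s, (g : Mat p q) = NormedSpace.exp X}

/-- The abelian factor `A = exp 𝔞`. -/
def groupA {p q : ℕ} (h : q ≤ p) : Subgroup (GLpq p q) := expGroup (Set.range (cartanElt h))

/-- The nilpotent factor `N`, the connected Lie subgroup with Lie algebra `𝔫`. -/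
def groupN {p q : ℕ} (h : q ≤ p) : Subgroup (GLpq p q) := expGroup (nilpotentPart h : Set (Mat p q))

/-- The group `K₀ ≅ SO(p - q)`: the rotations of `ℝ^{p+q}` that fix every standard basis vector
except (possibly) `e_1, …, e_{p-q}`. -/
def groupK₀ (p q : ℕ) : Subgroup (GLpq p q) where
  carrier := {g | (g : Mat p q) ∈ Matrix.specialOrthogonalGroup (Fin p ⊕ Fin q) ℝ ∧
    (∀ k : Fin p, p - q ≤ (k : ℕ) →
      (g : Mat p q) *ᵥ Pi.single (Sum.inl k) 1 = Pi.single (Sum.inl k) 1) ∧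
    ∀ j : Fin q, (g : Mat p q) *ᵥ Pi.single (Sum.inr j) 1 = Pi.single (Sum.inr j) 1}
  one_mem' := by
    refine ⟨?_, ?_, ?_⟩
    · rw [Units.val_one]
      exact one_mem _
    · intro k _
      rw [Units.val_one, Matrix.one_mulVec]
    · intro j
      rw [Units.val_one, Matrix.one_mulVec]
  mul_mem' := by
    rintro a b ⟨ha, ha', ha''⟩ ⟨hb, hb', hb''⟩
    refine ⟨?_, ?_, ?_⟩
    · rw [Units.val_mul]
      exact mul_mem ha hb
    · intro k hk
      rw [Units.val_mul, ← Matrix.mulVec_mulVec, hb' k hk, ha' k hk]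
    · intro j
      rw [Units.val_mul, ← Matrix.mulVec_mulVec, hb'' j, ha'' j]
  inv_mem' := by
    rintro a ⟨ha, ha', ha''⟩
    have key : ∀ v : Vec p q, (a : Mat p q) *ᵥ v = v → ((a⁻¹ : GLpq p q) : Mat p q) *ᵥ v = v := by
      intro v hv
      conv_lhs => rw [← hv]
      rw [Matrix.mulVec_mulVec, ← Units.val_mul, inv_mul_cancel, Units.val_one, Matrix.one_mulVec]
    refine ⟨?_, fun k hk => key _ (ha' k hk), fun j => key _ (ha'' j)⟩
    have h1 : ((a⁻¹ : GLpq p q) : Mat p q) = star (a : Mat p q) := by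
      have h2 : star (a : Mat p q) * (a : Mat p q) = 1 :=
        ((Matrix.mem_specialOrthogonalGroup_iff).1 ha).1.1
      calc ((a⁻¹ : GLpq p q) : Mat p q)
          = star (a : Mat p q) * (a : Mat p q) * ((a⁻¹ : GLpq p q) : Mat p q) := by
            rw [h2, one_mul]
        _ = star (a : Mat p q) := by
            rw [mul_assoc, ← Units.val_mul, mul_inv_cancel, Units.val_one, mul_one]
    rw [h1]
    exact (star (⟨_, ha⟩ : Matrix.specialOrthogonalGroup (Fin p ⊕ Fin q) ℝ)).2

/-- The group `K'AN` for a subgroup `K'` of `K₀`. (`A` and `K'` commute and both normalize `N`, so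
that the generated subgroup consists of the products `k a n`.) -/
def groupKAN {p q : ℕ} (h : q ≤ p) (K : Subgroup (GLpq p q)) : Subgroup (GLpq p q) :=
  K ⊔ groupA h ⊔ groupN h

/-! ### Linear actions -/

/-- The orbit of `x` under the linear action of `G`. -/
def orbitOf {p q : ℕ} (G : Subgroup (GLpq p q)) (x : Vec p q) : Set (Vec p q) :=
  {y | ∃ g ∈ G, y = (g : Mat p q) *ᵥ x}

/-- The action of `G` on `ℝ^{p,q}` is isometric. -/
def IsIsometricAction {p q : ℕ} (G : Subgroup (GLpq p q)) : Prop :=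
  ∀ g ∈ G, ∀ x y : Vec p q,
    scalarProd ((g : Mat p q) *ᵥ x) ((g : Mat p q) *ᵥ y) = scalarProd x y

/-- The matrices `X` with `exp (t X) ∈ G` for all real `t`: the Lie algebra of the Lie group
`G`. -/
def lieAlg {p q : ℕ} (G : Subgroup (GLpq p q)) : Set (Mat p q) :=
  {X | ∀ t : ℝ, ∃ g ∈ G, (g : Mat p q) = NormedSpace.exp (t • X)}

/-- The dimension of the orbit of `x`: that of its tangent space `{X x | X in the Lie algebra}`. -/
def orbitDim {p q : ℕ} (G : Subgroup (GLpq p q)) (x : Vec p q) : ℕ :=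
  Module.finrank ℝ (Submodule.span ℝ ((fun X : Mat p q => X *ᵥ x) '' lieAlg G))

/-- The action of `G` is of cohomogeneity one: the largest dimension of an orbit is
`p + q - 1`. -/
def IsCohomogeneityOne {p q : ℕ} (G : Subgroup (GLpq p q)) : Prop :=
  (∃ x : Vec p q, orbitDim G x + 1 = p + q) ∧ ∀ x : Vec p q, orbitDim G x + 1 ≤ p + q

/-- `G` and `H` are orbit-equivalent on `S`: some isometry of `ℝ^{p,q}` (an affine bijection whose
linear part preserves the scalar product) maps `S` onto `S`, and the `G`-orbits of points of `S`
onto `H`-orbits. -/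
def OrbitEquivalentOn {p q : ℕ} (G H : Subgroup (GLpq p q)) (S : Set (Vec p q)) : Prop :=
  ∃ f : Vec p q ≃ᵃ[ℝ] Vec p q,
    (∀ x y : Vec p q, scalarProd (f.linear x) (f.linear y) = scalarProd x y) ∧
    f '' S = S ∧ ∀ x ∈ S, f '' orbitOf G x = orbitOf H (f x)

/-- Weaker than orbit-equivalence on an invariant set `S`: some homeomorphism of `S` onto itself,
not necessarily isometric, maps the `G`-orbits in `S` onto the `H`-orbits in `S`. -/
def TopOrbitEquivalentOn {p q : ℕ} (G H : Subgroup (GLpq p q)) (S : Set (Vec p q)) : Prop :=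
  ∃ f : S ≃ₜ S, ∀ x y : S, (y : Vec p q) ∈ orbitOf G x ↔ (f y : Vec p q) ∈ orbitOf H (f x)

end PseudoEuclid

end

/-!
In the null coordinates `u_i = x^{p-i+1} + x^{p+i}` and `v_i = x^{p-i+1} - x^{p+i}` the subspace
`W^p` is given by `u = 0`; its radical is spanned by the null vectors `e_{p-i+1} - e_{p+i}`, and the
quotient by the radical is the middle space spanned by `e_1, …, e_{p-q}`. The group `A` scales the
`u_i`, and `𝔫` strictly raises the flag of the subspaces `u_1 = … = u_{i-1} = 0`, because all
positive roots are positive on one suitable element of `𝔞` (`nilpotentPart_le_raising`).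
Conversely `N` contains enough Siegel transvections `exp (z ∧ e)` along the null vectors
`e = e_{p-i+1} - e_{p+i}` to reduce every unipotent triangular isometry to the identity. Hence `K'AN`
is exactly the group of the isometries that preserve the flag, have positive diagonal entries, and
act on the middle space by an element of `K'` (`mem_groupKAN_iff`). Isometry, invariance of `W^p`
and closedness follow from this description.

The tangent space of an orbit at `x` lies in the orthogonal complement of `x`, since an isometric
action preserves `⟨x, x⟩`, and at `x = e_p + e_{p+1}` it is the whole complement; so the cohomogeneity
is one. Off `W^p` some `u_i` is nonzero, and a Siegel transvection then moves `x` to `k x` for every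
`k ∈ K₀` (`exists_mem_groupN_mulVec_eq`), so that `K'` has no influence on the orbits. On `W^p` the
middle component is moved by `K'` alone, which gives the comparison of orbits there.

For the last claim the trivial group is compared with `K₀`. An orbit of `AN` in `W^p` lies in a
translate of the radical, whose codimension in `W^p` is `p - q ≥ 2`, so its complement is connected.
The orbit of `e_1` under `K₀AN` is the product of the radical and a sphere, and separates `W^p`.
-/

noncomputable section

namespace PseudoEuclid

variable {p q : ℕ}

/-! ### The scalar product -/

/-- The scalar product of `ℝ^{p,q}` as a bilinear form. -/
def scalarForm (p q : ℕ) : Vec p q →ₗ[ℝ] Vec p q →ₗ[ℝ] ℝ :=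
  LinearMap.mk₂ ℝ scalarProd
    (fun x y z => by simp only [scalarProd, Pi.add_apply, add_mul, Finset.sum_add_distrib]; ring)
    (fun c x y => by
      simp only [scalarProd, Pi.smul_apply, smul_eq_mul, mul_assoc, ← Finset.mul_sum]; ring)
    (fun x y z => by simp only [scalarProd, Pi.add_apply, mul_add, Finset.sum_add_distrib]; ring)
    (fun c x y => by
      simp only [scalarProd, Pi.smul_apply, smul_eq_mul, mul_left_comm _ c, ← Finset.mul_sum]
      ring)

theorem scalarForm_apply (x y : Vec p q) : scalarForm p q x y = scalarProd x y := rfl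

theorem scalarProd_comm (x y : Vec p q) : scalarProd x y = scalarProd y x := by
  simp only [scalarProd, mul_comm]

theorem scalarProd_add_left (x y z : Vec p q) :
    scalarProd (x + y) z = scalarProd x z + scalarProd y z := by
  simp [← scalarForm_apply]

theorem scalarProd_add_right (x y z : Vec p q) :
    scalarProd x (y + z) = scalarProd x y + scalarProd x z := by
  simp [← scalarForm_apply]

theorem scalarProd_sub_left (x y z : Vec p q) :
    scalarProd (x - y) z = scalarProd x z - scalarProd y z := by
  simp [← scalarForm_apply]

theorem scalarProd_sub_right (x y z : Vec p q) :
    scalarProd x (y - z) = scalarProd x y - scalarProd x z := by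
  simp [← scalarForm_apply]

theorem scalarProd_smul_left (c : ℝ) (x y : Vec p q) :
    scalarProd (c • x) y = c * scalarProd x y := by
  simp [← scalarForm_apply]

theorem scalarProd_smul_right (c : ℝ) (x y : Vec p q) :
    scalarProd x (c • y) = c * scalarProd x y := by
  simp [← scalarForm_apply]

theorem scalarProd_eq_dotProduct (x y : Vec p q) :
    scalarProd x y =
      x ⬝ᵥ (LieAlgebra.Orthogonal.indefiniteDiagonal (Fin p) (Fin q) ℝ *ᵥ y) := by
  simp [scalarProd, LieAlgebra.Orthogonal.indefiniteDiagonal, Matrix.mulVec_diagonal,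
    dotProduct, sub_eq_add_neg]

/-- The scalar product is nondegenerate. -/
theorem eq_zero_of_scalarProd_eq_zero {x : Vec p q} (hx : ∀ y, scalarProd y x = 0) : x = 0 := by
  ext k
  rcases k with k | k
  · have := hx (Pi.single (Sum.inl k) 1)
    simpa [scalarProd, Pi.single_apply] using this
  · have := hx (Pi.single (Sum.inr k) 1)
    simpa [scalarProd, Pi.single_apply] using this

/-- `𝔰𝔬(p,q)` consists of the endomorphisms that are skew for the scalar product. -/
theorem mem_soPQ_iff (X : Mat p q) :
    X ∈ soPQ p q ↔ ∀ x y, scalarProd (X *ᵥ x) y + scalarProd x (X *ᵥ y) = 0 := by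
  set J := LieAlgebra.Orthogonal.indefiniteDiagonal (Fin p) (Fin q) ℝ with hJ
  have key : ∀ x y, scalarProd (X *ᵥ x) y + scalarProd x (X *ᵥ y) =
      x ⬝ᵥ ((Xᵀ * J + J * X) *ᵥ y) := by
    intro x y
    rw [scalarProd_eq_dotProduct, scalarProd_eq_dotProduct, Matrix.add_mulVec, dotProduct_add,
      ← Matrix.mulVec_mulVec, ← Matrix.mulVec_mulVec, ← hJ, Matrix.dotProduct_mulVec x Xᵀ,
      Matrix.vecMul_transpose]
  change Xᵀ * J + J * X = 0 ↔ _
  simp only [key]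
  constructor
  · intro h0 x y
    simp [h0]
  · intro h0
    ext i j
    simpa using h0 (Pi.single i 1) (Pi.single j 1)

/-! ### Null coordinates -/

/-- The null coordinate `u_i = x^{p-i+1} + x^{p+i}`, whose kernel is the hyperplane `Π_i`. -/
def nullU (h : q ≤ p) (i : Fin q) : Vec p q →ₗ[ℝ] ℝ :=
  (LinearMap.proj (Sum.inl (mirror h i)) : Vec p q →ₗ[ℝ] ℝ) + LinearMap.proj (Sum.inr i)

/-- The null coordinate `v_i = x^{p-i+1} - x^{p+i}`, dual to `u_i`. -/
def nullV (h : q ≤ p) (i : Fin q) : Vec p q →ₗ[ℝ] ℝ :=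
  (LinearMap.proj (Sum.inl (mirror h i)) : Vec p q →ₗ[ℝ] ℝ) - LinearMap.proj (Sum.inr i)

/-- The null vector `e_{p-i+1} + e_{p+i}`. -/
def posVec (h : q ≤ p) (i : Fin q) : Vec p q :=
  Pi.single (Sum.inl (mirror h i)) 1 + Pi.single (Sum.inr i) 1

/-- The null vector `e_{p-i+1} - e_{p+i}`. -/
def negVec (h : q ≤ p) (i : Fin q) : Vec p q :=
  Pi.single (Sum.inl (mirror h i)) 1 - Pi.single (Sum.inr i) 1

/-- The projection of `ℝ^{p+q}` onto the span of `e_1, …, e_{p-q}`. -/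
def midPart (p q : ℕ) : Vec p q →ₗ[ℝ] Vec p q where
  toFun x := Sum.elim (fun k => if (k : ℕ) < p - q then x (Sum.inl k) else 0) (fun _ => 0)
  map_add' x y := by ext (k | k) <;> simp [ite_add_zero]
  map_smul' c x := by ext (k | k) <;> simp

theorem nullU_apply (h : q ≤ p) (i : Fin q) (x : Vec p q) :
    nullU h i x = x (Sum.inl (mirror h i)) + x (Sum.inr i) := rfl

theorem nullV_apply (h : q ≤ p) (i : Fin q) (x : Vec p q) :
    nullV h i x = x (Sum.inl (mirror h i)) - x (Sum.inr i) := rfl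

theorem midPart_inl (x : Vec p q) (k : Fin p) :
    midPart p q x (Sum.inl k) = if (k : ℕ) < p - q then x (Sum.inl k) else 0 := rfl

theorem midPart_inr (x : Vec p q) (j : Fin q) : midPart p q x (Sum.inr j) = 0 := rfl

theorem mirror_val (h : q ≤ p) (i : Fin q) : (mirror h i : ℕ) = p - 1 - i := by
  simp only [mirror, Fin.val_rev, Fin.val_castLE]
  omega

theorem not_mirror_lt (h : q ≤ p) (i : Fin q) : ¬ (mirror h i : ℕ) < p - q := by
  rw [mirror_val]
  omega

theorem mirror_inj (h : q ≤ p) {i j : Fin q} : mirror h i = mirror h j ↔ i = j := by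
  simp [mirror]

theorem exists_mirror_eq (h : q ≤ p) {k : Fin p} (hk : ¬ (k : ℕ) < p - q) :
    ∃ i, mirror h i = k := by
  refine ⟨⟨p - 1 - k, by omega⟩, Fin.ext ?_⟩
  rw [mirror_val]
  simp only
  omega

theorem nullU_posVec (h : q ≤ p) (i j : Fin q) :
    nullU h i (posVec h j) = if i = j then 2 else 0 := by
  simp only [nullU_apply, posVec, Pi.add_apply, Pi.single_apply, Sum.inl.injEq, mirror_inj,
    Sum.inr.injEq, reduceCtorEq, if_false]
  split_ifs <;> norm_num

theorem nullU_negVec (h : q ≤ p) (i j : Fin q) : nullU h i (negVec h j) = 0 := by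
  simp only [nullU_apply, negVec, Pi.sub_apply, Pi.single_apply, Sum.inl.injEq, mirror_inj,
    Sum.inr.injEq, reduceCtorEq, if_false]
  split_ifs <;> norm_num

theorem nullV_posVec (h : q ≤ p) (i j : Fin q) : nullV h i (posVec h j) = 0 := by
  simp only [nullV_apply, posVec, Pi.add_apply, Pi.single_apply, Sum.inl.injEq, mirror_inj,
    Sum.inr.injEq, reduceCtorEq, if_false]
  split_ifs <;> norm_num

theorem nullV_negVec (h : q ≤ p) (i j : Fin q) :
    nullV h i (negVec h j) = if i = j then 2 else 0 := by
  simp only [nullV_apply, negVec, Pi.sub_apply, Pi.single_apply, Sum.inl.injEq, mirror_inj,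
    Sum.inr.injEq, reduceCtorEq, if_false]
  split_ifs <;> norm_num

theorem midPart_posVec (h : q ≤ p) (j : Fin q) : midPart p q (posVec h j) = 0 := by
  ext (k | k)
  · rw [midPart_inl]
    split_ifs with hk
    · have : k ≠ mirror h j := fun e => not_mirror_lt h j (e ▸ hk)
      simp [posVec, this]
    · rfl
  · rfl

theorem midPart_negVec (h : q ≤ p) (j : Fin q) : midPart p q (negVec h j) = 0 := by
  ext (k | k)
  · rw [midPart_inl]
    split_ifs with hk
    · have : k ≠ mirror h j := fun e => not_mirror_lt h j (e ▸ hk)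
      simp [negVec, this]
    · rfl
  · rfl

theorem midPart_midPart (x : Vec p q) : midPart p q (midPart p q x) = midPart p q x := by
  ext (k | k)
  · simp only [midPart_inl]
    split_ifs <;> rfl
  · rfl

theorem nullU_midPart (h : q ≤ p) (i : Fin q) (x : Vec p q) :
    nullU h i (midPart p q x) = 0 := by
  simp [nullU_apply, midPart_inl, midPart_inr, not_mirror_lt]

theorem nullV_midPart (h : q ≤ p) (i : Fin q) (x : Vec p q) :
    nullV h i (midPart p q x) = 0 := by
  simp [nullV_apply, midPart_inl, midPart_inr, not_mirror_lt]

/-- A vector is determined by its null coordinates and its middle part. -/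
theorem vec_ext (h : q ≤ p) {x y : Vec p q} (hu : ∀ i, nullU h i x = nullU h i y)
    (hv : ∀ i, nullV h i x = nullV h i y) (hm : midPart p q x = midPart p q y) : x = y := by
  have hr : ∀ i, x (Sum.inr i) = y (Sum.inr i) := fun i => by
    have h1 := hu i
    have h2 := hv i
    simp only [nullU_apply, nullV_apply] at h1 h2
    linarith
  ext (k | k)
  · by_cases hk : (k : ℕ) < p - q
    · simpa [midPart_inl, hk] using congrFun hm (Sum.inl k)
    · obtain ⟨i, rfl⟩ := exists_mirror_eq h hk
      have h1 := hu i
      simp only [nullU_apply, hr i] at h1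
      linarith
  · exact hr k

theorem eq_sum_null (h : q ≤ p) (x : Vec p q) :
    x = ∑ i, (nullU h i x / 2) • posVec h i + ∑ i, (nullV h i x / 2) • negVec h i +
      midPart p q x := by
  apply vec_ext h
  · intro i
    simp [nullU_posVec, nullU_negVec, nullU_midPart]
  · intro i
    simp [nullV_posVec, nullV_negVec, nullV_midPart]
  · simp [midPart_posVec, midPart_negVec, midPart_midPart]

theorem scalarProd_negVec (h : q ≤ p) (i : Fin q) (x : Vec p q) :
    scalarProd x (negVec h i) = nullU h i x := by
  simp [scalarProd, negVec, nullU_apply, Pi.single_apply]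

theorem scalarProd_posVec (h : q ≤ p) (i : Fin q) (x : Vec p q) :
    scalarProd x (posVec h i) = nullV h i x := by
  simp [scalarProd, posVec, nullV_apply, Pi.single_apply]

theorem mem_degSubspace_iff (h : q ≤ p) (x : Vec p q) :
    x ∈ degSubspace h ↔ ∀ i, nullU h i x = 0 := by
  simp only [degSubspace, Submodule.mem_iInf]
  rfl

theorem negVec_mem_degSubspace (h : q ≤ p) (i : Fin q) : negVec h i ∈ degSubspace h :=
  (mem_degSubspace_iff h _).2 fun j => nullU_negVec h j i

theorem midPart_mem_degSubspace (h : q ≤ p) (x : Vec p q) : midPart p q x ∈ degSubspace h :=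
  (mem_degSubspace_iff h _).2 fun j => nullU_midPart h j x

theorem finrank_degSubspace (h : q ≤ p) : Module.finrank ℝ (degSubspace h) = p := by
  let U : Vec p q →ₗ[ℝ] (Fin q → ℝ) := LinearMap.pi (nullU h)
  have hker : LinearMap.ker U = degSubspace h := by
    ext x
    rw [LinearMap.mem_ker, mem_degSubspace_iff]
    exact funext_iff
  have hsurj : LinearMap.range U = ⊤ := by
    rw [LinearMap.range_eq_top]
    intro c
    refine ⟨∑ i, (c i / 2) • posVec h i, ?_⟩
    ext i
    simp [U, nullU_posVec]
  have hdim := LinearMap.finrank_range_add_finrank_ker U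
  rw [hsurj, hker, finrank_top] at hdim
  simp only [Module.finrank_fintype_fun_eq_card, Fintype.card_fin, Fintype.card_sum] at hdim
  omega

/-! ### Exponentials of matrices acting on vectors -/

theorem hasSum_exp_mulVec {n : Type*} [Fintype n] [DecidableEq n] (X : Matrix n n ℝ) (x : n → ℝ) :
    HasSum (fun k : ℕ => ((k.factorial : ℝ)⁻¹) • ((X ^ k) *ᵥ x)) (NormedSpace.exp X *ᵥ x) := by
  let _ : NormedRing (Matrix n n ℝ) := Matrix.linftyOpNormedRing
  let _ : NormedAlgebra ℝ (Matrix n n ℝ) := Matrix.linftyOpNormedAlgebra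
  have h1 := NormedSpace.exp_series_hasSum_exp' (𝕂 := ℝ) X
  let L : Matrix n n ℝ →ₗ[ℝ] (n → ℝ) :=
    { toFun := fun A => A *ᵥ x
      map_add' := fun A B => Matrix.add_mulVec A B x
      map_smul' := fun c A => Matrix.smul_mulVec c A x }
  have h2 := h1.map L (LinearMap.continuous_of_finiteDimensional _)
  refine h2.congr_fun ?_
  intro k
  exact (Matrix.smul_mulVec _ _ x).symm

/-- If the submodule `S` is invariant under `X` and contains `X x`, then `exp X` moves `x` by an
element of `S`. -/
theorem exp_mulVec_sub_mem {n : Type*} [Fintype n] [DecidableEq n] {X : Matrix n n ℝ}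
    {S : Submodule ℝ (n → ℝ)} (hS : ∀ y ∈ S, X *ᵥ y ∈ S) {x : n → ℝ} (hx : X *ᵥ x ∈ S) :
    NormedSpace.exp X *ᵥ x - x ∈ S := by
  have h1 := (hasSum_nat_add_iff' 1).2 (hasSum_exp_mulVec X x)
  simp only [Finset.sum_range_one, Nat.factorial_zero, Nat.cast_one, inv_one, pow_zero,
    Matrix.one_mulVec, one_smul] at h1
  have hmem : ∀ k : ℕ, X ^ (k + 1) *ᵥ x ∈ S := by
    intro k
    induction k with
    | zero => simpa using hx
    | succ k ih => rw [pow_succ', ← Matrix.mulVec_mulVec]; exact hS _ ih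
  exact S.closed_of_finiteDimensional.mem_of_tendsto h1
    (.of_forall fun s => S.sum_mem fun k _ => S.smul_mem _ (hmem k))

/-- The second-order analogue of `exp_mulVec_sub_mem`: modulo `S`, the series of `exp X x` stops after
the linear term. -/
theorem exp_mulVec_sub_sub_mem {n : Type*} [Fintype n] [DecidableEq n] {X : Matrix n n ℝ}
    {S : Submodule ℝ (n → ℝ)} (hS : ∀ y ∈ S, X *ᵥ y ∈ S) {x : n → ℝ} (hx : X *ᵥ X *ᵥ x ∈ S) :
    NormedSpace.exp X *ᵥ x - (x + X *ᵥ x) ∈ S := by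
  have h1 := (hasSum_nat_add_iff' 2).2 (hasSum_exp_mulVec X x)
  simp only [Finset.sum_range_succ, Finset.sum_range_zero, zero_add, Nat.factorial_zero,
    Nat.factorial_one, Nat.cast_one, inv_one, pow_zero, pow_one, Matrix.one_mulVec, one_smul] at h1
  have hmem : ∀ k : ℕ, X ^ (k + 2) *ᵥ x ∈ S := by
    intro k
    induction k with
    | zero => simpa [pow_two, ← Matrix.mulVec_mulVec] using hx
    | succ k ih =>
      rw [show k + 1 + 2 = (k + 2) + 1 from rfl, pow_succ', ← Matrix.mulVec_mulVec]
      exact hS _ ih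
  exact S.closed_of_finiteDimensional.mem_of_tendsto h1
    (.of_forall fun s => S.sum_mem fun k _ => S.smul_mem _ (hmem k))

/-- A left eigenvector of `X` is a left eigenvector of `exp X`. -/
theorem map_exp_mulVec {n : Type*} [Fintype n] [DecidableEq n] {X : Matrix n n ℝ}
    {f : (n → ℝ) →ₗ[ℝ] ℝ} {c : ℝ} (hf : ∀ x, f (X *ᵥ x) = c * f x) (x : n → ℝ) :
    f (NormedSpace.exp X *ᵥ x) = Real.exp c * f x := by
  have h1 := (hasSum_exp_mulVec X x).map f (LinearMap.continuous_of_finiteDimensional _)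
  have h2 := (NormedSpace.exp_series_hasSum_exp' (𝕂 := ℝ) c).mul_right (f x)
  rw [← Real.exp_eq_exp_ℝ] at h2
  refine h1.unique ?_
  refine h2.congr_fun fun k => ?_
  have : f ((X ^ k) *ᵥ x) = c ^ k * f x := by
    induction k with
    | zero => simp
    | succ k ih => rw [pow_succ', ← Matrix.mulVec_mulVec, hf, ih, pow_succ']; ring
  simp [this, mul_assoc]

theorem scalarProd_exp_mulVec {X : Mat p q} (hX : X ∈ soPQ p q) (x y : Vec p q) :
    scalarProd (NormedSpace.exp X *ᵥ x) (NormedSpace.exp X *ᵥ y) = scalarProd x y := by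
  set J := LieAlgebra.Orthogonal.indefiniteDiagonal (Fin p) (Fin q) ℝ with hJ
  have hJJ : J * J = 1 := by
    rw [hJ, LieAlgebra.Orthogonal.indefiniteDiagonal, Matrix.diagonal_mul_diagonal,
      ← Matrix.diagonal_one]
    congr 1
    ext (i | i) <;> simp
  have hU : IsUnit J := IsUnit.of_mul_eq_one J hJJ
  have hinv : J⁻¹ = J := Matrix.inv_eq_right_inv hJJ
  have h0 : Xᵀ * J + J * X = 0 := hX
  have h1 : Xᵀ = J * (-X) * J⁻¹ := by
    rw [hinv, mul_neg, ← eq_neg_of_add_eq_zero_left h0, mul_assoc, hJJ, mul_one]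
  have h2 : (NormedSpace.exp X)ᵀ = J * NormedSpace.exp (-X) * J := by
    rw [← Matrix.exp_transpose, h1, Matrix.exp_conj J _ hU, hinv]
  have h3 : (NormedSpace.exp X)ᵀ * J * NormedSpace.exp X = J := by
    rw [h2, mul_assoc, mul_assoc, ← mul_assoc J J, hJJ, one_mul, mul_assoc, Matrix.exp_neg,
      Matrix.nonsing_inv_mul _ ((Matrix.isUnit_iff_isUnit_det _).1 (Matrix.isUnit_exp X)), mul_one]
  rw [scalarProd_eq_dotProduct, scalarProd_eq_dotProduct, ← hJ, ← Matrix.vecMul_transpose,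
    ← Matrix.dotProduct_mulVec, Matrix.mulVec_mulVec, Matrix.mulVec_mulVec, h3]

/-- The exponential of a matrix, as an invertible matrix. -/
def expGL (X : Mat p q) : GLpq p q := (Matrix.isUnit_exp X).unit

theorem coe_expGL (X : Mat p q) : (expGL X : Mat p q) = NormedSpace.exp X := rfl

theorem expGL_mem_expGroup {s : Set (Mat p q)} {X : Mat p q} (hX : X ∈ s) :
    expGL X ∈ expGroup s :=
  Subgroup.subset_closure ⟨X, hX, rfl⟩

/-! ### The Lie algebras `𝔞` and `𝔫` -/

theorem cartanElt_mulVec_inl (h : q ≤ p) (c : Fin q → ℝ) (x : Vec p q) (i : Fin q) :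
    (cartanElt h c *ᵥ x) (Sum.inl (mirror h i)) = c i * x (Sum.inr i) := by
  simp [cartanElt, Matrix.mulVec, dotProduct, mirror_inj]

theorem cartanElt_mulVec_inr (h : q ≤ p) (c : Fin q → ℝ) (x : Vec p q) (i : Fin q) :
    (cartanElt h c *ᵥ x) (Sum.inr i) = c i * x (Sum.inl (mirror h i)) := by
  simp [cartanElt, Matrix.mulVec, dotProduct]

theorem nullU_cartanElt_mulVec (h : q ≤ p) (c : Fin q → ℝ) (i : Fin q) (x : Vec p q) :
    nullU h i (cartanElt h c *ᵥ x) = c i * nullU h i x := by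
  rw [nullU_apply, cartanElt_mulVec_inl, cartanElt_mulVec_inr, nullU_apply]
  ring

theorem nullV_cartanElt_mulVec (h : q ≤ p) (c : Fin q → ℝ) (i : Fin q) (x : Vec p q) :
    nullV h i (cartanElt h c *ᵥ x) = -c i * nullV h i x := by
  rw [nullV_apply, cartanElt_mulVec_inl, cartanElt_mulVec_inr, nullV_apply]
  ring

theorem cartanElt_mulVec_mid (h : q ≤ p) (c : Fin q → ℝ) (x : Vec p q) {k : Fin p}
    (hk : (k : ℕ) < p - q) : (cartanElt h c *ᵥ x) (Sum.inl k) = 0 := by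
  have hne : ∀ i, k ≠ mirror h i := fun i e => not_mirror_lt h i (e ▸ hk)
  simp [cartanElt, Matrix.mulVec, dotProduct, hne]

theorem midPart_eq_zero_iff {x : Vec p q} :
    midPart p q x = 0 ↔ ∀ k : Fin p, (k : ℕ) < p - q → x (Sum.inl k) = 0 := by
  constructor
  · intro hx k hk
    simpa [midPart_inl, hk] using congrFun hx (Sum.inl k)
  · intro hx
    ext (k | k)
    · rw [midPart_inl]
      split_ifs with hk
      · exact hx k hk
      · rfl
    · rfl

theorem midPart_cartanElt_mulVec (h : q ≤ p) (c : Fin q → ℝ) (x : Vec p q) :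
    midPart p q (cartanElt h c *ᵥ x) = 0 :=
  midPart_eq_zero_iff.2 fun _ => cartanElt_mulVec_mid h c x

theorem cartanElt_mulVec_posVec (h : q ≤ p) (c : Fin q → ℝ) (i : Fin q) :
    cartanElt h c *ᵥ posVec h i = c i • posVec h i := by
  apply vec_ext h
  · intro j
    rw [nullU_cartanElt_mulVec, map_smul, nullU_posVec, smul_eq_mul]
    split_ifs with e <;> simp [e]
  · intro j
    simp [nullV_cartanElt_mulVec, nullV_posVec]
  · simp [midPart_cartanElt_mulVec, midPart_posVec]

theorem cartanElt_mulVec_negVec (h : q ≤ p) (c : Fin q → ℝ) (i : Fin q) :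
    cartanElt h c *ᵥ negVec h i = (-c i) • negVec h i := by
  apply vec_ext h
  · intro j
    simp [nullU_cartanElt_mulVec, nullU_negVec]
  · intro j
    rw [nullV_cartanElt_mulVec, map_smul, nullV_negVec, smul_eq_mul]
    split_ifs with e <;> simp [e]
  · simp [midPart_cartanElt_mulVec, midPart_negVec]

theorem cartanElt_mulVec_midPart (h : q ≤ p) (c : Fin q → ℝ) (x : Vec p q) :
    cartanElt h c *ᵥ midPart p q x = 0 := by
  apply vec_ext h
  · intro j
    simp [nullU_cartanElt_mulVec, nullU_midPart]
  · intro j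
    simp [nullV_cartanElt_mulVec, nullV_midPart]
  · simp [midPart_cartanElt_mulVec]

theorem cartanElt_mem_soPQ (h : q ≤ p) (c : Fin q → ℝ) : cartanElt h c ∈ soPQ p q := by
  have hdiag : (Matrix.diagonal fun _ : Fin q => (-1 : ℝ)) = -1 := by
    rw [← Matrix.diagonal_one, Matrix.diagonal_neg]
  change _ + _ = _
  simp [hdiag, cartanElt, LieAlgebra.Orthogonal.indefiniteDiagonal, ← Matrix.fromBlocks_diagonal,
    Matrix.fromBlocks_transpose, Matrix.fromBlocks_multiply, Matrix.fromBlocks_add]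

theorem nilpotentPart_le {h : q ≤ p} {S : Submodule ℝ (Mat p q)}
    (h1 : ∀ l, rootSpace h (rootF l) ≤ S)
    (h2 : ∀ i j, i < j → rootSpace h (rootF i - rootF j) ≤ S)
    (h3 : ∀ i j, i < j → rootSpace h (rootF i + rootF j) ≤ S) : nilpotentPart h ≤ S :=
  sup_le (iSup_le h1) (iSup_le fun i => iSup_le fun j => iSup_le fun hij =>
    sup_le (h2 i j hij) (h3 i j hij))

theorem nilpotentPart_le_soPQ (h : q ≤ p) : nilpotentPart h ≤ soPQ p q :=
  nilpotentPart_le (fun _ _ hX => hX.1) (fun _ _ _ _ hX => hX.1) (fun _ _ _ _ hX => hX.1)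

/-- The endomorphisms that strictly raise the flag of the subspaces `u_0 = … = u_{i-1} = 0` (with
indices counted from `0`), and map its last member `W^p` into its radical. -/
def raising (h : q ≤ p) : Submodule ℝ (Mat p q) where
  carrier := {X | (∀ i x, (∀ j < i, nullU h j x = 0) → nullU h i (X *ᵥ x) = 0) ∧
    ∀ x ∈ degSubspace h, midPart p q (X *ᵥ x) = 0}
  zero_mem' := by simp
  add_mem' := by
    rintro X Y ⟨hX, hX'⟩ ⟨hY, hY'⟩
    refine ⟨fun i x hx => ?_, fun x hx => ?_⟩
    · rw [Matrix.add_mulVec, map_add, hX i x hx, hY i x hx, add_zero]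
    · rw [Matrix.add_mulVec, map_add, hX' x hx, hY' x hx, add_zero]
  smul_mem' := by
    rintro r X ⟨hX, hX'⟩
    refine ⟨fun i x hx => ?_, fun x hx => ?_⟩
    · rw [Matrix.smul_mulVec, map_smul, hX i x hx, smul_zero]
    · rw [Matrix.smul_mulVec, map_smul, hX' x hx, smul_zero]

/-- If `[D, X] = r X`, then `X` shifts the eigenvalues of `D` by `r`, so that it has no component from
an eigenvector `e` to a left eigenvector `f` unless the eigenvalues fit. -/
theorem map_mulVec_eq_zero_of_weights {n : Type*} [Fintype n] {D X : Matrix n n ℝ} {r d ε : ℝ}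
    (hX : D * X - X * D = r • X) {f : (n → ℝ) →ₗ[ℝ] ℝ} (hf : ∀ y, f (D *ᵥ y) = d * f y)
    {e : n → ℝ} (he : D *ᵥ e = ε • e) (hne : d - ε - r ≠ 0) : f (X *ᵥ e) = 0 := by
  have h1 := congrArg (fun M => f (M *ᵥ e)) hX
  simp only [Matrix.sub_mulVec, ← Matrix.mulVec_mulVec, he, map_sub, hf, Matrix.mulVec_smul,
    map_smul, Matrix.smul_mulVec, smul_eq_mul] at h1
  refine (mul_eq_zero.1 (?_ : (d - ε - r) * f (X *ᵥ e) = 0)).resolve_left hne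
  linarith

/-- An element of `𝔫` strictly raises the eigenvalues of the element `H_c`, `c_i = i - q` (with
`i` counted from `0`), on which all positive roots are positive. -/
theorem mem_raising_of_weight {h : q ≤ p} {X : Mat p q} {r : ℝ} (hr : 0 < r)
    (hX : cartanElt h (fun i => (i : ℝ) - q) * X - X * cartanElt h (fun i => (i : ℝ) - q) =
      r • X) : X ∈ raising h := by
  have hlt : ∀ i : Fin q, (i : ℝ) < q := fun i => by exact_mod_cast i.2
  refine ⟨fun i x hx => ?_, fun x hx => midPart_eq_zero_iff.2 fun k hk => ?_⟩
  · have hU := nullU_cartanElt_mulVec h (fun i => (i : ℝ) - q) i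
    have hpos : ∀ j, nullU h j x / 2 * nullU h i (X *ᵥ posVec h j) = 0 := by
      intro j
      rcases lt_or_ge j i with hj | hj
      · rw [hx j hj, zero_div, zero_mul]
      · have hij : (i : ℝ) ≤ j := by exact_mod_cast hj
        rw [map_mulVec_eq_zero_of_weights hX hU (cartanElt_mulVec_posVec h _ j)
          (by linarith), mul_zero]
    have hneg : ∀ j, nullU h i (X *ᵥ negVec h j) = 0 := fun j =>
      map_mulVec_eq_zero_of_weights hX hU (cartanElt_mulVec_negVec h _ j)
        (by linarith [hlt i, hlt j])
    have hmid : nullU h i (X *ᵥ midPart p q x) = 0 :=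
      map_mulVec_eq_zero_of_weights hX hU (ε := 0)
        (by rw [cartanElt_mulVec_midPart, zero_smul]) (by linarith [hlt i])
    rw [eq_sum_null h x]
    simp [Matrix.mulVec_add, Matrix.mulVec_sum, Matrix.mulVec_smul, hpos, hneg, hmid]
  · let f : Vec p q →ₗ[ℝ] ℝ := LinearMap.proj (Sum.inl k)
    have hf : ∀ y, f (cartanElt h (fun i => (i : ℝ) - q) *ᵥ y) = 0 * f y := fun y => by
      rw [zero_mul]
      exact cartanElt_mulVec_mid h _ y hk
    have hneg : ∀ j, f (X *ᵥ negVec h j) = 0 := fun j =>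
      map_mulVec_eq_zero_of_weights hX hf (cartanElt_mulVec_negVec h _ j)
        (by linarith [hlt j])
    have hmid : f (X *ᵥ midPart p q x) = 0 :=
      map_mulVec_eq_zero_of_weights hX hf (ε := 0)
        (by rw [cartanElt_mulVec_midPart, zero_smul]) (by linarith)
    change f (X *ᵥ x) = 0
    rw [eq_sum_null h x]
    simp [Matrix.mulVec_add, Matrix.mulVec_sum, Matrix.mulVec_smul, hneg, hmid,
      (mem_degSubspace_iff h x).1 hx]

theorem nilpotentPart_le_raising (h : q ≤ p) : nilpotentPart h ≤ raising h := by
  have hlt : ∀ i : Fin q, (i : ℝ) < q := fun i => by exact_mod_cast i.2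
  refine nilpotentPart_le (fun l X hX => ?_) (fun i j hij X hX => ?_) fun i j hij X hX => ?_
  · refine mem_raising_of_weight ?_ (hX.2 _)
    simp [rootF]
  · refine mem_raising_of_weight ?_ (hX.2 _)
    simpa [rootF] using hij
  · refine mem_raising_of_weight ?_ (hX.2 _)
    simp only [rootF, LinearMap.add_apply, LinearMap.neg_apply, LinearMap.proj_apply]
    linarith [hlt i, hlt j]

/-- The skew endomorphism `z ∧ e`, given by `x ↦ ⟨x, e⟩ z - ⟨x, z⟩ e`. -/
def wedge (z e : Vec p q) : Mat p q :=
  LinearMap.toMatrix' (((scalarForm p q).flip e).smulRight z - ((scalarForm p q).flip z).smulRight e)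

theorem wedge_mulVec (z e x : Vec p q) :
    wedge z e *ᵥ x = scalarProd x e • z - scalarProd x z • e := by
  rw [wedge, LinearMap.toMatrix'_mulVec]
  rfl

theorem mat_ext {A B : Mat p q} (hAB : ∀ x, A *ᵥ x = B *ᵥ x) : A = B :=
  Matrix.mulVec_injective (funext hAB)

theorem wedge_mem_soPQ (z e : Vec p q) : wedge z e ∈ soPQ p q := by
  rw [mem_soPQ_iff]
  intro x y
  simp only [wedge_mulVec, scalarProd_sub_left, scalarProd_sub_right, scalarProd_smul_left,
    scalarProd_smul_right, scalarProd_comm z, scalarProd_comm e]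
  ring

/-- `z ∧ e` as a linear function of `z`. -/
def wedgeL (e : Vec p q) : Vec p q →ₗ[ℝ] Mat p q where
  toFun z := wedge z e
  map_add' x y := mat_ext fun w => by
    simp only [Matrix.add_mulVec, wedge_mulVec, scalarProd_add_right, smul_add, add_smul]
    abel
  map_smul' c x := mat_ext fun w => by
    simp only [Matrix.smul_mulVec, wedge_mulVec, scalarProd_smul_right, RingHom.id_apply, smul_sub,
      smul_smul, mul_comm c]

theorem commutator_wedge {X : Mat p q} (hX : X ∈ soPQ p q) (z e : Vec p q) :
    X * wedge z e - wedge z e * X = wedge (X *ᵥ z) e + wedge z (X *ᵥ e) := by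
  refine mat_ext fun x => ?_
  have h1 := (mem_soPQ_iff X).1 hX x e
  have h2 := (mem_soPQ_iff X).1 hX x z
  simp only [Matrix.sub_mulVec, Matrix.add_mulVec, ← Matrix.mulVec_mulVec, wedge_mulVec,
    Matrix.mulVec_sub, Matrix.mulVec_smul, eq_neg_of_add_eq_zero_right h1,
    eq_neg_of_add_eq_zero_right h2, neg_smul]
  abel

theorem wedge_negVec_mem_rootSpace (h : q ≤ p) {z : Vec p q} {i : Fin q}
    {α : Module.Dual ℝ (Fin q → ℝ)} (hz : ∀ c, cartanElt h c *ᵥ z = (α c + c i) • z) :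
    wedge z (negVec h i) ∈ rootSpace h α := by
  refine ⟨wedge_mem_soPQ _ _, fun c => ?_⟩
  rw [commutator_wedge (cartanElt_mem_soPQ h c), hz, cartanElt_mulVec_negVec]
  refine mat_ext fun x => ?_
  simp only [Matrix.add_mulVec, Matrix.smul_mulVec, wedge_mulVec, scalarProd_smul_right]
  module

/-- The elements of `𝔫` from which the Siegel transvections along `e_{p-i+1} - e_{p+i}` arise. -/
theorem wedge_negVec_mem_nilpotentPart (h : q ≤ p) {i : Fin q} {z : Vec p q}
    (hu : ∀ j ≤ i, nullU h j z = 0) (hv : ∀ j ≤ i, nullV h j z = 0) :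
    wedge z (negVec h i) ∈ nilpotentPart h := by
  have hpair : ∀ j, i < j → rootSpace h (rootF i - rootF j) ⊔ rootSpace h (rootF i + rootF j) ≤
      nilpotentPart h := fun j hij =>
    le_sup_of_le_right (le_iSup_of_le i (le_iSup_of_le j (le_iSup_of_le hij le_rfl)))
  change wedgeL (negVec h i) z ∈ nilpotentPart h
  rw [eq_sum_null h z, map_add, map_add, map_sum, map_sum]
  refine add_mem (add_mem (sum_mem fun j _ => ?_) (sum_mem fun j _ => ?_)) ?_
  · rw [map_smul]
    rcases le_or_gt j i with hj | hj
    · rw [hu j hj, zero_div, zero_smul]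
      exact zero_mem _
    · refine Submodule.smul_mem _ _ (hpair j hj (Submodule.mem_sup_left ?_))
      refine wedge_negVec_mem_rootSpace h fun c => ?_
      rw [cartanElt_mulVec_posVec]
      congr 1
      simp [rootF]
  · rw [map_smul]
    rcases le_or_gt j i with hj | hj
    · rw [hv j hj, zero_div, zero_smul]
      exact zero_mem _
    · refine Submodule.smul_mem _ _ (hpair j hj (Submodule.mem_sup_right ?_))
      refine wedge_negVec_mem_rootSpace h fun c => ?_
      rw [cartanElt_mulVec_negVec]
      congr 1
      simp [rootF]
  · refine (le_sup_of_le_left (le_iSup_of_le i le_rfl) :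
      rootSpace h (rootF i) ≤ nilpotentPart h) (wedge_negVec_mem_rootSpace h fun c => ?_)
    rw [cartanElt_mulVec_midPart]
    simp [rootF]

theorem wedge_midPart_negVec_mem_nilpotentPart (h : q ≤ p) (i : Fin q) (z : Vec p q) :
    wedge (midPart p q z) (negVec h i) ∈ nilpotentPart h :=
  wedge_negVec_mem_nilpotentPart h (fun _ _ => nullU_midPart h _ _) fun _ _ => nullV_midPart h _ _

theorem expGL_mem_groupN {h : q ≤ p} {X : Mat p q} (hX : X ∈ nilpotentPart h) :
    expGL X ∈ groupN h :=
  expGL_mem_expGroup hX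

theorem expGL_mem_groupA (h : q ≤ p) (c : Fin q → ℝ) : expGL (cartanElt h c) ∈ groupA h :=
  expGL_mem_expGroup ⟨c, rfl⟩

/-- The action of a Siegel transvection, up to the direction of its axis; the coefficient `t` is
determined by the invariance of the scalar product. -/
theorem exists_exp_wedge_mulVec (h : q ≤ p) {i : Fin q} {z : Vec p q} (hz : nullU h i z = 0)
    (x : Vec p q) : ∃ t : ℝ, NormedSpace.exp (wedge z (negVec h i)) *ᵥ x =
      x + nullU h i x • z + t • negVec h i := by
  set X := wedge z (negVec h i) with hXdef
  have hXe : X *ᵥ negVec h i = 0 := by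
    rw [hXdef, wedge_mulVec, scalarProd_negVec, nullU_negVec, scalarProd_comm, scalarProd_negVec,
      hz, zero_smul, zero_smul, sub_zero]
  have hX : ∀ y, X *ᵥ y = nullU h i y • z - scalarProd y z • negVec h i := fun y => by
    rw [hXdef, wedge_mulVec, scalarProd_negVec]
  have h1 : NormedSpace.exp X *ᵥ x - (x + X *ᵥ x) ∈ ℝ ∙ negVec h i := by
    refine exp_mulVec_sub_sub_mem (fun y hy => ?_) ?_
    · obtain ⟨s, rfl⟩ := Submodule.mem_span_singleton.1 hy
      rw [Matrix.mulVec_smul, hXe, smul_zero]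
      exact zero_mem _
    · rw [hX x, Matrix.mulVec_sub, Matrix.mulVec_smul, Matrix.mulVec_smul, hXe, hX z, hz, zero_smul,
        zero_sub, smul_zero, sub_zero, smul_neg]
      exact neg_mem (Submodule.smul_mem _ _ (Submodule.smul_mem _ _
        (Submodule.mem_span_singleton_self _)))
  obtain ⟨s, hs⟩ := Submodule.mem_span_singleton.1 h1
  refine ⟨s - scalarProd x z, ?_⟩
  rw [sub_smul, hs, hX x]
  abel

/-- On the hyperplane `u_i = 0` a Siegel transvection is a shear along its axis. -/
theorem exp_wedge_mulVec_of_nullU_eq_zero (h : q ≤ p) {i : Fin q} {z : Vec p q}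
    (hz : nullU h i z = 0) {x : Vec p q} (hx : nullU h i x = 0) :
    NormedSpace.exp (wedge z (negVec h i)) *ᵥ x = x - scalarProd x z • negVec h i := by
  set X := wedge z (negVec h i) with hXdef
  have hXx : X *ᵥ x = -(scalarProd x z • negVec h i) := by
    rw [hXdef, wedge_mulVec, scalarProd_negVec, hx, zero_smul, zero_sub]
  have hXe : X *ᵥ negVec h i = 0 := by
    rw [hXdef, wedge_mulVec, scalarProd_negVec, nullU_negVec, scalarProd_comm, scalarProd_negVec,
      hz, zero_smul, zero_smul, sub_zero]
  have h1 : NormedSpace.exp X *ᵥ x - (x + X *ᵥ x) ∈ (⊥ : Submodule ℝ (Vec p q)) := by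
    refine exp_mulVec_sub_sub_mem (fun y hy => ?_) ?_
    · rw [(Submodule.mem_bot ℝ).1 hy, Matrix.mulVec_zero]
      exact zero_mem _
    · rw [hXx, Matrix.mulVec_neg, Matrix.mulVec_smul, hXe, smul_zero, neg_zero]
      exact zero_mem _
  rw [sub_eq_zero.1 ((Submodule.mem_bot ℝ).1 h1), hXx, sub_eq_add_neg]

/-! ### The rotation group `K₀` -/

section Rotations

variable {k : GLpq p q}

theorem dotProduct_mulVec_of_mem_groupK₀ (hk : k ∈ groupK₀ p q) (x y : Vec p q) :
    ((k : Mat p q) *ᵥ x) ⬝ᵥ ((k : Mat p q) *ᵥ y) = x ⬝ᵥ y := by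
  have h1 : (k : Mat p q)ᵀ * (k : Mat p q) = 1 :=
    ((Matrix.mem_specialOrthogonalGroup_iff).1 hk.1).1.1
  rw [← Matrix.vecMul_transpose, ← Matrix.dotProduct_mulVec, Matrix.mulVec_mulVec, h1,
    Matrix.one_mulVec]

theorem mulVec_eq_self_of_mem_groupK₀ (hk : k ∈ groupK₀ p q) {x : Vec p q}
    (hx : midPart p q x = 0) : (k : Mat p q) *ᵥ x = x := by
  have hsum : x = ∑ j, x j • Pi.single j (1 : ℝ) := pi_eq_sum_univ' x
  conv_lhs => rw [hsum]
  conv_rhs => rw [hsum]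
  rw [Matrix.mulVec_sum]
  refine Finset.sum_congr rfl fun j _ => ?_
  rw [Matrix.mulVec_smul]
  rcases j with j | j
  · by_cases hj : (j : ℕ) < p - q
    · rw [midPart_eq_zero_iff.1 hx j hj, zero_smul, zero_smul]
    · rw [hk.2.1 j (not_lt.1 hj)]
  · rw [hk.2.2 j]

theorem mulVec_apply_inl_of_mem_groupK₀ (hk : k ∈ groupK₀ p q) (x : Vec p q) {j : Fin p}
    (hj : p - q ≤ (j : ℕ)) : ((k : Mat p q) *ᵥ x) (Sum.inl j) = x (Sum.inl j) := by
  have h1 := dotProduct_mulVec_of_mem_groupK₀ hk (Pi.single (Sum.inl j) 1) x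
  rwa [hk.2.1 j hj, single_one_dotProduct, single_one_dotProduct] at h1

theorem mulVec_apply_inr_of_mem_groupK₀ (hk : k ∈ groupK₀ p q) (x : Vec p q) (j : Fin q) :
    ((k : Mat p q) *ᵥ x) (Sum.inr j) = x (Sum.inr j) := by
  have h1 := dotProduct_mulVec_of_mem_groupK₀ hk (Pi.single (Sum.inr j) 1) x
  rwa [hk.2.2 j, single_one_dotProduct, single_one_dotProduct] at h1

theorem nullU_mulVec_of_mem_groupK₀ (h : q ≤ p) (hk : k ∈ groupK₀ p q) (i : Fin q) (x : Vec p q) :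
    nullU h i ((k : Mat p q) *ᵥ x) = nullU h i x := by
  rw [nullU_apply, nullU_apply, mulVec_apply_inr_of_mem_groupK₀ hk,
    mulVec_apply_inl_of_mem_groupK₀ hk x (not_lt.1 (not_mirror_lt h i))]

theorem nullV_mulVec_of_mem_groupK₀ (h : q ≤ p) (hk : k ∈ groupK₀ p q) (i : Fin q) (x : Vec p q) :
    nullV h i ((k : Mat p q) *ᵥ x) = nullV h i x := by
  rw [nullV_apply, nullV_apply, mulVec_apply_inr_of_mem_groupK₀ hk,
    mulVec_apply_inl_of_mem_groupK₀ hk x (not_lt.1 (not_mirror_lt h i))]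

theorem midPart_mulVec_of_mem_groupK₀ (h : q ≤ p) (hk : k ∈ groupK₀ p q) (x : Vec p q) :
    midPart p q ((k : Mat p q) *ᵥ x) = (k : Mat p q) *ᵥ midPart p q x := by
  have h1 : (k : Mat p q) *ᵥ (x - midPart p q x) = x - midPart p q x :=
    mulVec_eq_self_of_mem_groupK₀ hk (by rw [map_sub, midPart_midPart, sub_self])
  rw [Matrix.mulVec_sub, sub_eq_iff_eq_add] at h1
  rw [h1, map_add, map_sub, midPart_midPart, sub_self, zero_add]
  apply vec_ext h
  · intro i
    rw [nullU_midPart, nullU_mulVec_of_mem_groupK₀ h hk, nullU_midPart]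
  · intro i
    rw [nullV_midPart, nullV_mulVec_of_mem_groupK₀ h hk, nullV_midPart]
  · rw [midPart_midPart]

theorem scalarProd_eq_dotProduct_sub (x y : Vec p q) :
    scalarProd x y = x ⬝ᵥ y - 2 * ∑ j : Fin q, x (Sum.inr j) * y (Sum.inr j) := by
  simp only [scalarProd, dotProduct, Fintype.sum_sum_type]
  ring

theorem scalarProd_mulVec_of_mem_groupK₀ (hk : k ∈ groupK₀ p q) (x y : Vec p q) :
    scalarProd ((k : Mat p q) *ᵥ x) ((k : Mat p q) *ᵥ y) = scalarProd x y := by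
  simp only [scalarProd_eq_dotProduct_sub, dotProduct_mulVec_of_mem_groupK₀ hk,
    mulVec_apply_inr_of_mem_groupK₀ hk]

end Rotations

/-! ### The groups `K'AN` as groups of triangular isometries -/

/-- The matrix `g` is an isometry that preserves the flag of the subspaces
`u_0 = … = u_{i-1} = 0` (with indices counted from `0`), with diagonal entries `a_i`, and acts on
the quotient of `W^p` by its radical as `k` does. -/
structure IsTriangular (h : q ≤ p) (g k : Mat p q) (a : Fin q → ℝ) : Prop where
  isometric : ∀ x y, scalarProd (g *ᵥ x) (g *ᵥ y) = scalarProd x y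
  diag : ∀ i x, (∀ j < i, nullU h j x = 0) → nullU h i (g *ᵥ x) = a i * nullU h i x
  mid : ∀ x ∈ degSubspace h, midPart p q (g *ᵥ x) = midPart p q (k *ᵥ x)

variable {h : q ≤ p}

theorem GLpq_mulVec_inv_mulVec (g : GLpq p q) (x : Vec p q) :
    (g : Mat p q) *ᵥ ((g⁻¹ : GLpq p q) : Mat p q) *ᵥ x = x := by
  rw [Matrix.mulVec_mulVec, ← Units.val_mul, mul_inv_cancel, Units.val_one, Matrix.one_mulVec]

theorem GLpq_inv_mulVec_mulVec (g : GLpq p q) (x : Vec p q) :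
    ((g⁻¹ : GLpq p q) : Mat p q) *ᵥ (g : Mat p q) *ᵥ x = x := by
  rw [Matrix.mulVec_mulVec, ← Units.val_mul, inv_mul_cancel, Units.val_one, Matrix.one_mulVec]

namespace IsTriangular

theorem mulVec_mem {g k : Mat p q} {a : Fin q → ℝ} (hg : IsTriangular h g k a)
    {x : Vec p q} (hx : x ∈ degSubspace h) : g *ᵥ x ∈ degSubspace h := by
  rw [mem_degSubspace_iff] at hx ⊢
  intro i
  rw [hg.diag i x fun j _ => hx j, hx i, mul_zero]

theorem mul {g g' : Mat p q} {k : GLpq p q} {k' : Mat p q} {a a' : Fin q → ℝ}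
    (hk : k ∈ groupK₀ p q) (hg : IsTriangular h g k a) (hg' : IsTriangular h g' k' a') :
    IsTriangular h (g * g') (k * k') (a * a') where
  isometric x y := by
    rw [← Matrix.mulVec_mulVec, ← Matrix.mulVec_mulVec, hg.isometric, hg'.isometric]
  diag i x hx := by
    have hx' : ∀ j < i, nullU h j (g' *ᵥ x) = 0 := fun j hj => by
      rw [hg'.diag j x fun l hl => hx l (hl.trans hj), hx j hj, mul_zero]
    rw [← Matrix.mulVec_mulVec, hg.diag i _ hx', hg'.diag i x hx, Pi.mul_apply, mul_assoc]
  mid x hx := by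
    rw [← Matrix.mulVec_mulVec, ← Matrix.mulVec_mulVec, hg.mid _ (hg'.mulVec_mem hx),
      midPart_mulVec_of_mem_groupK₀ h hk, hg'.mid x hx, ← midPart_mulVec_of_mem_groupK₀ h hk]

theorem inv {g k : GLpq p q} {a : Fin q → ℝ} (hk : k ∈ groupK₀ p q)
    (ha : ∀ i, 0 < a i) (hg : IsTriangular h g k a) :
    IsTriangular h (g⁻¹ : GLpq p q) (k⁻¹ : GLpq p q) a⁻¹ := by
  have hflag : ∀ (i : Fin q) x, (∀ j < i, nullU h j x = 0) →
      ∀ j < i, nullU h j (((g⁻¹ : GLpq p q) : Mat p q) *ᵥ x) = 0 := by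
    intro i x hx j
    induction j using WellFoundedLT.induction with
    | ind j ih =>
      intro hj
      have h1 := hg.diag j _ fun l hl => ih l hl (hl.trans hj)
      rw [GLpq_mulVec_inv_mulVec, hx j hj] at h1
      exact (mul_eq_zero.1 h1.symm).resolve_left (ha j).ne'
  refine ⟨fun x y => ?_, fun i x hx => ?_, fun x hx => ?_⟩
  · rw [← hg.isometric, GLpq_mulVec_inv_mulVec, GLpq_mulVec_inv_mulVec]
  · have h1 := hg.diag i _ (hflag i x hx)
    rw [GLpq_mulVec_inv_mulVec] at h1
    rw [h1, Pi.inv_apply, inv_mul_cancel_left₀ (ha i).ne']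
  · have hmem : ((g⁻¹ : GLpq p q) : Mat p q) *ᵥ x ∈ degSubspace h := by
      rw [mem_degSubspace_iff] at hx ⊢
      intro i
      have h1 := hg.diag i _ (hflag i x fun j _ => hx j)
      rw [GLpq_mulVec_inv_mulVec, hx i] at h1
      exact (mul_eq_zero.1 h1.symm).resolve_left (ha i).ne'
    have h1 := hg.mid _ hmem
    rw [GLpq_mulVec_inv_mulVec] at h1
    rw [midPart_mulVec_of_mem_groupK₀ h (inv_mem hk), h1, midPart_mulVec_of_mem_groupK₀ h hk,
      GLpq_inv_mulVec_mulVec]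

theorem of_mem_groupK₀ (h : q ≤ p) {k : GLpq p q} (hk : k ∈ groupK₀ p q) :
    IsTriangular h k k 1 where
  isometric := scalarProd_mulVec_of_mem_groupK₀ hk
  diag i x _ := by rw [nullU_mulVec_of_mem_groupK₀ h hk, Pi.one_apply, one_mul]
  mid _ _ := rfl

theorem exp_cartanElt (h : q ≤ p) (c : Fin q → ℝ) :
    IsTriangular h (NormedSpace.exp (cartanElt h c)) 1 (fun i => Real.exp (c i)) where
  isometric := scalarProd_exp_mulVec (cartanElt_mem_soPQ h c)
  diag i x _ := map_exp_mulVec (nullU_cartanElt_mulVec h c i) x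
  mid x _ := by
    rw [Matrix.one_mulVec, ← sub_eq_zero, ← map_sub, midPart_eq_zero_iff]
    intro k hk
    have h1 := map_exp_mulVec (X := cartanElt h c) (c := 0)
      (f := (LinearMap.proj (Sum.inl k) : Vec p q →ₗ[ℝ] ℝ))
      (fun y => by rw [zero_mul]; exact cartanElt_mulVec_mid h c y hk) x
    rw [Real.exp_zero, one_mul] at h1
    exact sub_eq_zero.2 h1

theorem exp_of_mem_nilpotentPart {X : Mat p q} (hX : X ∈ nilpotentPart h) :
    IsTriangular h (NormedSpace.exp X) 1 1 := by
  obtain ⟨hU, hM⟩ := nilpotentPart_le_raising h hX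
  refine ⟨scalarProd_exp_mulVec (nilpotentPart_le_soPQ h hX), fun i x hx => ?_, fun x hx => ?_⟩
  · have h1 : NormedSpace.exp X *ᵥ x - x ∈
        (⨅ j : Fin q, ⨅ _ : j ≤ i, LinearMap.ker (nullU h j) : Submodule ℝ (Vec p q)) := by
      refine exp_mulVec_sub_mem (fun y hy => ?_) ?_
      · simp only [Submodule.mem_iInf, LinearMap.mem_ker] at hy ⊢
        exact fun j hj => hU j y fun l hl => hy l (hl.le.trans hj)
      · simp only [Submodule.mem_iInf, LinearMap.mem_ker]
        exact fun j hj => hU j x fun l hl => hx l (hl.trans_le hj)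
    simp only [Submodule.mem_iInf, LinearMap.mem_ker] at h1
    have h2 := h1 i le_rfl
    rw [map_sub, sub_eq_zero] at h2
    rw [h2, Pi.one_apply, one_mul]
  · have hrad : ∀ y ∈ degSubspace h, X *ᵥ y ∈ degSubspace h ⊓ LinearMap.ker (midPart p q) :=
      fun y hy => ⟨(mem_degSubspace_iff h _).2 fun j =>
        hU j y fun l _ => (mem_degSubspace_iff h y).1 hy l, hM y hy⟩
    have h1 := (exp_mulVec_sub_mem (fun y hy => hrad y hy.1) (hrad x hx)).2
    rw [SetLike.mem_coe, LinearMap.mem_ker, map_sub, sub_eq_zero] at h1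
    rw [h1, Matrix.one_mulVec]

end IsTriangular

/-- The group of the triangular isometries with positive diagonal whose middle block belongs to
`K`. It turns out to be `KAN`. -/
def triangularGroup (h : q ≤ p) (K : Subgroup (GLpq p q)) (hK : K ≤ groupK₀ p q) :
    Subgroup (GLpq p q) where
  carrier := {g | ∃ k ∈ K, ∃ a : Fin q → ℝ, (∀ i, 0 < a i) ∧ IsTriangular h g (k : Mat p q) a}
  one_mem' := ⟨1, one_mem K, 1, fun _ => one_pos, IsTriangular.of_mem_groupK₀ h (one_mem _)⟩
  mul_mem' := by
    rintro g g' ⟨k, hk, a, ha, hg⟩ ⟨k', hk', a', ha', hg'⟩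
    exact ⟨k * k', mul_mem hk hk', a * a', fun i => mul_pos (ha i) (ha' i), hg.mul (hK hk) hg'⟩
  inv_mem' := by
    rintro g ⟨k, hk, a, ha, hg⟩
    exact ⟨k⁻¹, inv_mem hk, a⁻¹, fun i => inv_pos.2 (ha i), hg.inv (hK hk) ha⟩

theorem groupKAN_le_triangularGroup (h : q ≤ p) {K : Subgroup (GLpq p q)}
    (hK : K ≤ groupK₀ p q) : groupKAN h K ≤ triangularGroup h K hK := by
  refine sup_le (sup_le (fun k hk => ?_) ((Subgroup.closure_le _).2 ?_))
    ((Subgroup.closure_le _).2 ?_)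
  · exact ⟨k, hk, 1, fun _ => one_pos, IsTriangular.of_mem_groupK₀ h (hK hk)⟩
  · rintro g ⟨_, ⟨c, rfl⟩, hg⟩
    refine ⟨1, one_mem K, _, fun i => Real.exp_pos (c i), ?_⟩
    rw [hg]
    exact IsTriangular.exp_cartanElt h c
  · rintro g ⟨X, hX, hg⟩
    refine ⟨1, one_mem K, 1, fun _ => one_pos, ?_⟩
    rw [hg]
    exact IsTriangular.exp_of_mem_nilpotentPart hX

theorem isTriangular_of_mem_groupN {m : GLpq p q} (hm : m ∈ groupN h) :
    IsTriangular h (m : Mat p q) 1 1 := by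
  refine Subgroup.closure_induction 
    (p := fun (m : GLpq p q) _ => IsTriangular h (m : Mat p q) 1 1)
    ?_ ?_ ?_ ?_ hm
  · rintro g ⟨X, hX, hg⟩
    rw [hg]
    exact IsTriangular.exp_of_mem_nilpotentPart hX
  · exact IsTriangular.of_mem_groupK₀ h (one_mem _)
  · intro g g' _ _ hg hg'
    simpa using hg.mul (k := 1) (one_mem _) hg'
  · intro g _ hg
    have h1 := IsTriangular.inv (k := 1) (a := 1) (one_mem _) (fun _ => one_pos) hg
    rwa [inv_one, inv_one] at h1

/-- A triangular isometry with trivial diagonal part that fixes the vectors `e_{p-i+1} + e_{p+i}`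
is the identity: by invariance of the scalar product it also preserves the coordinates `v_i`. -/
theorem IsTriangular.eq_one {g : Mat p q} (hg : IsTriangular h g 1 1)
    (hfix : ∀ i, g *ᵥ posVec h i = posVec h i) : g = 1 := by
  have hV : ∀ x i, nullV h i (g *ᵥ x) = nullV h i x := fun x i => by
    rw [← scalarProd_posVec, ← scalarProd_posVec]
    conv_lhs => rw [← hfix i]
    exact hg.isometric _ _
  have hW : ∀ x ∈ degSubspace h, g *ᵥ x = x := fun x hx => by
    refine vec_ext h (fun i => ?_) (hV x) ?_
    · rw [(mem_degSubspace_iff h _).1 (hg.mulVec_mem hx), (mem_degSubspace_iff h _).1 hx]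
    · rw [hg.mid x hx, Matrix.one_mulVec]
  refine mat_ext fun x => ?_
  rw [Matrix.one_mulVec]
  conv_lhs => rw [eq_sum_null h x]
  conv_rhs => rw [eq_sum_null h x]
  simp only [Matrix.mulVec_add, Matrix.mulVec_sum, Matrix.mulVec_smul, hfix,
    hW _ (negVec_mem_degSubspace h _), hW _ (midPart_mem_degSubspace h x)]

/-- Elimination by Siegel transvections: a unipotent triangular isometry can be multiplied by an
element of `N` so that it fixes the first `n` of the vectors `e_{p-i+1} + e_{p+i}`. -/
theorem exists_mul_fixes_posVec (h : q ≤ p) (n : ℕ) (hn : n ≤ q) {g : GLpq p q}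
    (hg : IsTriangular h g 1 1) : ∃ m ∈ groupN h, ∀ j : Fin q, (j : ℕ) < n →
      ((m * g : GLpq p q) : Mat p q) *ᵥ posVec h j = posVec h j := by
  induction n with
  | zero => exact ⟨1, one_mem _, fun j hj => absurd hj (Nat.not_lt_zero _)⟩
  | succ n ih =>
    obtain ⟨m, hm, hfix⟩ := ih (by omega)
    set i : Fin q := ⟨n, by omega⟩ with hi
    have hmg : IsTriangular h ((m * g : GLpq p q) : Mat p q) 1 1 := by
      simpa using (isTriangular_of_mem_groupN hm).mul (k := 1) (one_mem _) hg
    set G : Mat p q := ((m * g : GLpq p q) : Mat p q) with hG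
    set y := G *ᵥ posVec h i with hy
    have hyU : ∀ j ≤ i, nullU h j y = nullU h j (posVec h i) := fun j hj => by
      rw [hy, hmg.diag j _ fun l hl => ?_, Pi.one_apply, one_mul]
      rw [nullU_posVec, if_neg (hl.trans_le hj).ne]
    have hyV : ∀ j < i, nullV h j y = 0 := fun j hj => by
      rw [← scalarProd_posVec, hy, ← hfix j hj, hmg.isometric, scalarProd_posVec, nullV_posVec]
    -- The transvection vector removes everything but the components along the null vectors with
    -- index `i` (the factor `-1/2` below compensates `u_i y = 2`); the component along
    -- `e_{p-i+1} - e_{p+i}` then vanishes since `y` is isotropic.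
    set z : Vec p q := y - posVec h i - (nullV h i y / 2) • negVec h i with hz
    have hzU : ∀ j ≤ i, nullU h j z = 0 := fun j hj => by
      simp [hz, hyU j hj, nullU_negVec]
    have hzV : ∀ j ≤ i, nullV h j z = 0 := fun j hj => by
      rcases hj.lt_or_eq with hj | rfl
      · simp [hz, hyV j hj, nullV_posVec, nullV_negVec, hj.ne]
      · simp [hz, nullV_posVec, nullV_negVec]
    have hw : wedge (-(1 / 2 : ℝ) • z) (negVec h i) ∈ nilpotentPart h :=
      wedge_negVec_mem_nilpotentPart h (fun j hj => by rw [map_smul, hzU j hj, smul_zero])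
        fun j hj => by rw [map_smul, hzV j hj, smul_zero]
    have hzi : nullU h i (-(1 / 2 : ℝ) • z) = 0 := by rw [map_smul, hzU i le_rfl, smul_zero]
    refine ⟨expGL (wedge (-(1 / 2 : ℝ) • z) (negVec h i)) * m,
      mul_mem (expGL_mem_groupN hw) hm, fun j hj => ?_⟩
    rw [mul_assoc, Units.val_mul, ← Matrix.mulVec_mulVec, coe_expGL, ← hG]
    rcases Nat.lt_succ_iff_lt_or_eq.1 hj with hj | hj
    · have hji : j < i := hj
      rw [hfix j hj, exp_wedge_mulVec_of_nullU_eq_zero h hzi (by rw [nullU_posVec, if_neg hji.ne'])]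
      rw [scalarProd_comm, scalarProd_posVec, map_smul, hzV j hji.le, smul_zero, zero_smul,
        sub_zero]
    · obtain rfl : j = i := Fin.ext hj
      rw [← hy]
      obtain ⟨t, ht⟩ := exists_exp_wedge_mulVec h hzi y
      have hyi : nullU h i y = 2 := by rw [hyU i le_rfl, nullU_posVec, if_pos rfl]
      have ht' : NormedSpace.exp (wedge (-(1 / 2 : ℝ) • z) (negVec h i)) *ᵥ y =
          posVec h i + (nullV h i y / 2 + t) • negVec h i := by
        rw [ht, hyi, hz]
        module
      have hiso := (IsTriangular.exp_of_mem_nilpotentPart hw).isometric y y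
      rw [ht', hy, hmg.isometric, ← hy] at hiso
      simp only [scalarProd_add_right, scalarProd_smul_right, scalarProd_posVec,
        scalarProd_negVec, map_add, map_smul, smul_eq_mul, nullV_posVec, nullV_negVec,
        nullU_posVec, nullU_negVec, if_true] at hiso
      have ht0 : nullV h i y / 2 + t = 0 := by linarith
      rw [ht', ht0, zero_smul, add_zero]

theorem mem_groupN_of_isTriangular {g : GLpq p q} (hg : IsTriangular h g 1 1) : g ∈ groupN h := by
  obtain ⟨m, hm, hfix⟩ := exists_mul_fixes_posVec h q le_rfl hg
  have hmg : IsTriangular h ((m * g : GLpq p q) : Mat p q) 1 1 := by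
    simpa using (isTriangular_of_mem_groupN hm).mul (k := 1) (one_mem _) hg
  have h1 : m * g = 1 := Units.ext (hmg.eq_one fun i => hfix i i.2)
  rw [eq_inv_of_mul_eq_one_right h1]
  exact inv_mem hm

/-- `KAN` is the group of the triangular isometries with positive diagonal whose middle block belongs
to `K`: dividing by `k` and by the element of `A` with the same diagonal leaves a unipotent one. -/
theorem mem_groupKAN_iff (h : q ≤ p) {K : Subgroup (GLpq p q)} (hK : K ≤ groupK₀ p q)
    (g : GLpq p q) : g ∈ groupKAN h K ↔
      ∃ k ∈ K, ∃ a : Fin q → ℝ, (∀ i, 0 < a i) ∧ IsTriangular h g (k : Mat p q) a := by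
  refine ⟨fun hg => groupKAN_le_triangularGroup h hK hg, ?_⟩
  rintro ⟨k, hk, a, ha, hg⟩
  let b : GLpq p q := expGL (cartanElt h fun i => Real.log (a i))
  have hb : IsTriangular h b ((1 : GLpq p q) : Mat p q) a := by
    have h1 := IsTriangular.exp_cartanElt h fun i => Real.log (a i)
    simp only [Real.exp_log (ha _)] at h1
    exact h1
  have hkb := hb.mul (one_mem _) (IsTriangular.of_mem_groupK₀ h (hK hk))
  have h2 := (IsTriangular.inv (g := b * k) (k := 1 * k) (mul_mem (one_mem _) (hK hk))
    (fun i => mul_pos (ha i) one_pos) hkb).mul (mul_mem (one_mem _) (hK hk) |> inv_mem) hg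
  have h3 : (b * k)⁻¹ * g ∈ groupN h := by
    apply mem_groupN_of_isTriangular
    convert h2 using 1
    · rw [Units.val_mul]
    · rw [one_mul, ← Units.val_mul, inv_mul_cancel, Units.val_one]
    · funext i
      simp [(ha i).ne']
  have hKle : K ≤ groupKAN h K := le_sup_of_le_left le_sup_left
  have hAle : groupA h ≤ groupKAN h K := le_sup_of_le_left le_sup_right
  have hNle : groupN h ≤ groupKAN h K := le_sup_right
  have h4 : b * k * ((b * k)⁻¹ * g) ∈ groupKAN h K :=
    mul_mem (mul_mem (hAle (expGL_mem_groupA h _)) (hKle hk)) (hNle h3)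
  rwa [mul_inv_cancel_left] at h4

theorem groupKAN_mono (h : q ≤ p) {K K' : Subgroup (GLpq p q)} (hK : K ≤ K') :
    groupKAN h K ≤ groupKAN h K' :=
  sup_le_sup_right (sup_le_sup_right hK _) _

theorem le_groupKAN (h : q ≤ p) (K : Subgroup (GLpq p q)) : K ≤ groupKAN h K :=
  le_sup_of_le_left le_sup_left

theorem groupN_le_groupKAN (h : q ≤ p) (K : Subgroup (GLpq p q)) : groupN h ≤ groupKAN h K :=
  le_sup_right

/-- Every element of `KAN` is the product of an element of `AN` and one of `K`. -/
theorem exists_eq_mul_of_mem_groupKAN (h : q ≤ p) {K : Subgroup (GLpq p q)}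
    (hK : K ≤ groupK₀ p q) {g : GLpq p q} (hg : g ∈ groupKAN h K) :
    ∃ b ∈ groupKAN h ⊥, ∃ k ∈ K, g = b * k := by
  obtain ⟨k, hk, a, ha, hgk⟩ := (mem_groupKAN_iff h hK g).1 hg
  refine ⟨g * k⁻¹, (mem_groupKAN_iff h bot_le _).2 ⟨1, one_mem _, a, ha, ?_⟩, k, hk,
    (inv_mul_cancel_right g k).symm⟩
  have h1 := hgk.mul (hK hk) (IsTriangular.of_mem_groupK₀ h (inv_mem (hK hk)))
  rwa [mul_one, ← Units.val_mul, ← Units.val_mul, mul_inv_cancel] at h1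

theorem isIsometricAction_groupKAN (h : q ≤ p) {K : Subgroup (GLpq p q)}
    (hK : K ≤ groupK₀ p q) : IsIsometricAction (groupKAN h K) := by
  intro g hg
  obtain ⟨k, -, a, -, hgk⟩ := (mem_groupKAN_iff h hK g).1 hg
  exact hgk.isometric

theorem orbitOf_groupKAN_subset (h : q ≤ p) {K : Subgroup (GLpq p q)}
    (hK : K ≤ groupK₀ p q) {x : Vec p q} (hx : x ∈ degSubspace h) :
    orbitOf (groupKAN h K) x ⊆ degSubspace h := by
  rintro _ ⟨g, hg, rfl⟩
  obtain ⟨k, -, a, -, hgk⟩ := (mem_groupKAN_iff h hK g).1 hg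
  exact hgk.mulVec_mem hx

/-! ### Closedness of `K'AN` -/

/-- The matrix with the same middle block as `g` that is the identity off the middle block. -/
def midBlock (g : Mat p q) : Mat p q :=
  LinearMap.toMatrix' (midPart p q) * g * LinearMap.toMatrix' (midPart p q) +
    (1 - LinearMap.toMatrix' (midPart p q))

theorem midBlock_mulVec (g : Mat p q) (x : Vec p q) :
    midBlock g *ᵥ x = midPart p q (g *ᵥ midPart p q x) + (x - midPart p q x) := by
  simp only [midBlock, Matrix.add_mulVec, Matrix.sub_mulVec, Matrix.one_mulVec,
    ← Matrix.mulVec_mulVec, LinearMap.toMatrix'_mulVec]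

theorem continuous_midBlock : Continuous (midBlock : Mat p q → Mat p q) := by
  unfold midBlock
  fun_prop

theorem IsTriangular.midBlock_eq {h : q ≤ p} {g : Mat p q} {k : GLpq p q} {a : Fin q → ℝ}
    (hk : k ∈ groupK₀ p q) (hg : IsTriangular h g k a) : midBlock g = k := by
  refine mat_ext fun x => ?_
  rw [midBlock_mulVec, hg.mid _ (midPart_mem_degSubspace h x), midPart_mulVec_of_mem_groupK₀ h hk,
    midPart_midPart]
  have h1 : (k : Mat p q) *ᵥ (x - midPart p q x) = x - midPart p q x :=
    mulVec_eq_self_of_mem_groupK₀ hk (by rw [map_sub, midPart_midPart, sub_self])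
  rw [← h1, ← Matrix.mulVec_add, add_sub_cancel]

/-- A closed subgroup of `K₀` is closed in the space of all matrices, invertible or not. -/
theorem isClosed_image_val {K : Subgroup (GLpq p q)} (hK : K ≤ groupK₀ p q)
    (hcl : IsClosed (K : Set (GLpq p q))) :
    IsClosed ((fun k : GLpq p q => (k : Mat p q)) '' (K : Set (GLpq p q))) := by
  refine isClosed_of_closure_subset fun A hA => ?_
  have horth : A * Aᵀ = 1 := by
    have hclosed : IsClosed {B : Mat p q | B * Bᵀ = 1} :=
      isClosed_eq (by fun_prop) continuous_const
    refine closure_minimal ?_ hclosed hA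
    rintro _ ⟨k, hk, rfl⟩
    exact ((Matrix.mem_specialOrthogonalGroup_iff).1 (hK hk).1).1.2
  obtain ⟨g, rfl⟩ : IsUnit A := IsUnit.of_mul_eq_one _ horth
  let _ : NormedRing (Mat p q) := Matrix.linftyOpNormedRing
  let _ : NormedAlgebra ℝ (Mat p q) := Matrix.linftyOpNormedAlgebra
  have hind : Topology.IsInducing (Units.val : GLpq p q → Mat p q) :=
    (Units.isOpenEmbedding_val (R := Mat p q)).isInducing
  refine ⟨g, ?_, rfl⟩
  rw [← hcl.closure_eq, hind.closure_eq_preimage_closure_image]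
  exact hA

theorem continuous_val_mulVec (x : Vec p q) : Continuous fun g : GLpq p q => (g : Mat p q) *ᵥ x :=
  Units.continuous_val.matrix_mulVec continuous_const

/-- Membership in `KAN` is a closed condition: the diagonal entries depend continuously on `g`,
and stay positive in the limit since those of `g⁻¹` are their inverses. -/
theorem isClosed_groupKAN (h : q ≤ p) {K : Subgroup (GLpq p q)} (hK : K ≤ groupK₀ p q)
    (hcl : IsClosed (K : Set (GLpq p q))) : IsClosed (groupKAN h K : Set (GLpq p q)) := by
  refine isClosed_of_closure_subset fun g hg => ?_
  have key : ∀ S : Set (GLpq p q), IsClosed S → (groupKAN h K : Set (GLpq p q)) ⊆ S → g ∈ S :=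
    fun S hS hsub => closure_minimal hsub hS hg
  have hform : Continuous fun z : Vec p q × Vec p q => scalarProd z.1 z.2 := by
    unfold scalarProd
    fun_prop
  have hU : ∀ i, Continuous (nullU h i) := fun i => LinearMap.continuous_of_finiteDimensional _
  have hM : Continuous (midPart p q) := LinearMap.continuous_of_finiteDimensional _
  let d : Fin q → GLpq p q → ℝ := fun i b => nullU h i ((b : Mat p q) *ᵥ posVec h i) / 2
  have hd : ∀ i, Continuous (d i) := fun i =>
    ((hU i).comp (continuous_val_mulVec _)).div_const 2
  have hdiag : ∀ {b k : Mat p q} {a : Fin q → ℝ} (i : Fin q), IsTriangular h b k a →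
      nullU h i (b *ᵥ posVec h i) / 2 = a i := by
    intro b k a i hb
    rw [hb.diag i _ fun j hj => by rw [nullU_posVec, if_neg hj.ne], nullU_posVec, if_pos rfl]
    ring
  have hiso : ∀ x y, scalarProd ((g : Mat p q) *ᵥ x) ((g : Mat p q) *ᵥ y) = scalarProd x y :=
    fun x y => key {b | scalarProd ((b : Mat p q) *ᵥ x) ((b : Mat p q) *ᵥ y) = scalarProd x y}
      (isClosed_eq (hform.comp ((continuous_val_mulVec x).prodMk (continuous_val_mulVec y)))
        continuous_const)
      fun b hb => isIsometricAction_groupKAN h hK b hb x y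
  have hflag : ∀ i x, (∀ j < i, nullU h j x = 0) →
      nullU h i ((g : Mat p q) *ᵥ x) = d i g * nullU h i x := fun i x hx =>
    key {b | nullU h i ((b : Mat p q) *ᵥ x) = d i b * nullU h i x}
      (isClosed_eq ((hU i).comp (continuous_val_mulVec x)) ((hd i).mul continuous_const))
      fun b hb => by
        obtain ⟨k, -, a, -, hbk⟩ := (mem_groupKAN_iff h hK b).1 hb
        change _ = nullU h i ((b : Mat p q) *ᵥ posVec h i) / 2 * _
        rw [hdiag i hbk, hbk.diag i x hx]
  have hnonneg : ∀ i, 0 ≤ d i g := fun i =>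
    key {b | 0 ≤ d i b} (isClosed_le continuous_const (hd i)) fun b hb => by
      obtain ⟨k, -, a, ha, hbk⟩ := (mem_groupKAN_iff h hK b).1 hb
      change 0 ≤ nullU h i ((b : Mat p q) *ᵥ posVec h i) / 2
      rw [hdiag i hbk]
      exact (ha i).le
  have hinv : ∀ i, d i g * d i g⁻¹ = 1 := fun i =>
    key {b | d i b * d i b⁻¹ = 1}
      (isClosed_eq ((hd i).mul ((hd i).comp continuous_inv)) continuous_const) fun b hb => by
      obtain ⟨k, hk, a, ha, hbk⟩ := (mem_groupKAN_iff h hK b).1 hb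
      change nullU h i ((b : Mat p q) *ᵥ posVec h i) / 2 *
        (nullU h i (((b⁻¹ : GLpq p q) : Mat p q) *ᵥ posVec h i) / 2) = 1
      rw [hdiag i hbk, hdiag i (hbk.inv (hK hk) ha), Pi.inv_apply, mul_inv_cancel₀ (ha i).ne']
  have hpos : ∀ i, 0 < d i g := fun i =>
    lt_of_le_of_ne (hnonneg i) fun h0 => by simpa [← h0] using hinv i
  obtain ⟨k, hk, hkg⟩ := key
    {b | midBlock (b : Mat p q) ∈ (fun k : GLpq p q => (k : Mat p q)) '' (K : Set (GLpq p q))}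
    ((isClosed_image_val hK hcl).preimage (continuous_midBlock.comp Units.continuous_val))
    fun b hb => by
      obtain ⟨k, hk, a, -, hbk⟩ := (mem_groupKAN_iff h hK b).1 hb
      exact ⟨k, hk, (hbk.midBlock_eq (hK hk)).symm⟩
  refine (mem_groupKAN_iff h hK g).2 ⟨k, hk, fun i => d i g, hpos, hiso, hflag, fun x hx => ?_⟩
  simp only at hkg
  rw [hkg]
  refine key {b | midPart p q ((b : Mat p q) *ᵥ x) = midPart p q (midBlock (b : Mat p q) *ᵥ x)}
    (isClosed_eq (hM.comp (continuous_val_mulVec x))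
      (hM.comp ((continuous_midBlock.comp Units.continuous_val).matrix_mulVec continuous_const)))
    fun b hb => ?_
  obtain ⟨k', hk', a, -, hbk⟩ := (mem_groupKAN_iff h hK b).1 hb
  change _ = midPart p q (midBlock (b : Mat p q) *ᵥ x)
  rw [hbk.midBlock_eq (hK hk'), hbk.mid x hx]

/-! ### Cohomogeneity one -/

theorem hasDerivAt_map_exp_smul_mulVec {n : Type*} [Fintype n] [DecidableEq n]
    (X : Matrix n n ℝ) (f : (n → ℝ) →ₗ[ℝ] ℝ) (x : n → ℝ) :
    HasDerivAt (fun t : ℝ => f (NormedSpace.exp (t • X) *ᵥ x)) (f (X *ᵥ x)) 0 := by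
  let _ : NormedRing (Matrix n n ℝ) := Matrix.linftyOpNormedRing
  let _ : NormedAlgebra ℝ (Matrix n n ℝ) := Matrix.linftyOpNormedAlgebra
  let L : Matrix n n ℝ →ₗ[ℝ] ℝ :=
    { toFun := fun A => f (A *ᵥ x)
      map_add' := fun A B => by rw [Matrix.add_mulVec, map_add]
      map_smul' := fun c A => by rw [Matrix.smul_mulVec, map_smul, RingHom.id_apply] }
  have h1 := hasDerivAt_exp_smul_const (𝕂 := ℝ) X 0
  rw [zero_smul, NormedSpace.exp_zero, one_mul] at h1
  exact (LinearMap.toContinuousLinearMap L).hasFDerivAt.comp_hasDerivAt (0 : ℝ) h1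

/-- The orbits of an isometric action are tangent to the level sets of the scalar square. -/
theorem scalarProd_mulVec_self_of_mem_lieAlg {G : Subgroup (GLpq p q)}
    (hG : IsIsometricAction G) {X : Mat p q} (hX : X ∈ lieAlg G) (x : Vec p q) :
    scalarProd x (X *ᵥ x) = 0 := by
  -- The function `t ↦ ⟨x, exp (t X) x⟩` is even.
  have hderiv := hasDerivAt_map_exp_smul_mulVec X (scalarForm p q x) x
  have heven : ∀ t : ℝ, scalarForm p q x (NormedSpace.exp (-t • X) *ᵥ x) =
      scalarForm p q x (NormedSpace.exp (t • X) *ᵥ x) := by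
    intro t
    obtain ⟨g, hg, hgX⟩ := hX t
    have hexp : NormedSpace.exp (t • X) * NormedSpace.exp (-t • X) = 1 := by
      rw [neg_smul, Matrix.exp_neg, Matrix.mul_nonsing_inv _
        ((Matrix.isUnit_iff_isUnit_det _).1 (Matrix.isUnit_exp (t • X)))]
    have hinv : NormedSpace.exp (t • X) *ᵥ NormedSpace.exp (-t • X) *ᵥ x = x := by
      rw [Matrix.mulVec_mulVec, hexp, Matrix.one_mulVec]
    rw [scalarForm_apply, scalarForm_apply,
      ← hG g hg x (NormedSpace.exp (-t • X) *ᵥ x), hgX, hinv, scalarProd_comm]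
  have hneg : HasDerivAt (fun t : ℝ => -t) (-1) 0 := (hasDerivAt_id 0).neg
  have h2 : HasDerivAt (fun t : ℝ => scalarForm p q x (NormedSpace.exp (-t • X) *ᵥ x))
      (scalarForm p q x (X *ᵥ x) * -1) 0 :=
    HasDerivAt.comp (0 : ℝ)
      (h₂ := fun t : ℝ => scalarForm p q x (NormedSpace.exp (t • X) *ᵥ x))
      (by rw [neg_zero]; exact hderiv) hneg
  simp only [heven] at h2
  have h3 := hderiv.unique h2
  rw [scalarForm_apply] at h3
  linarith

theorem orbitDim_add_one_le {G : Subgroup (GLpq p q)} (hG : IsIsometricAction G) (hp : 0 < p)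
    (x : Vec p q) : orbitDim G x + 1 ≤ p + q := by
  have hcard : Module.finrank ℝ (Vec p q) = p + q := by simp
  by_cases hx : x = 0
  · have h0 : Submodule.span ℝ ((fun X : Mat p q => X *ᵥ x) '' lieAlg G) = ⊥ := by
      rw [Submodule.span_eq_bot]
      rintro _ ⟨X, -, rfl⟩
      simp [hx]
    rw [orbitDim, h0, finrank_bot]
    omega
  · have hf : scalarForm p q x ≠ 0 := fun h0 => hx (eq_zero_of_scalarProd_eq_zero fun y => by
      rw [scalarProd_comm, ← scalarForm_apply, h0, LinearMap.zero_apply])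
    have hle : Submodule.span ℝ ((fun X : Mat p q => X *ᵥ x) '' lieAlg G) ≤
        LinearMap.ker (scalarForm p q x) := by
      rw [Submodule.span_le]
      rintro _ ⟨X, hX, rfl⟩
      exact scalarProd_mulVec_self_of_mem_lieAlg hG hX x
    rw [← hcard, ← Module.Dual.finrank_ker_add_one_of_ne_zero hf]
    exact Nat.add_le_add_right (Submodule.finrank_mono hle) 1

theorem smul_cartanElt (h : q ≤ p) (t : ℝ) (c : Fin q → ℝ) :
    t • cartanElt h c = cartanElt h (t • c) := by
  refine mat_ext fun x => vec_ext h (fun i => ?_) (fun i => ?_) ?_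
  · rw [Matrix.smul_mulVec, map_smul, nullU_cartanElt_mulVec, nullU_cartanElt_mulVec,
      Pi.smul_apply, smul_eq_mul, smul_eq_mul, mul_assoc]
  · rw [Matrix.smul_mulVec, map_smul, nullV_cartanElt_mulVec, nullV_cartanElt_mulVec,
      Pi.smul_apply, smul_eq_mul, smul_eq_mul]
    ring
  · rw [Matrix.smul_mulVec, map_smul, midPart_cartanElt_mulVec, midPart_cartanElt_mulVec,
      smul_zero]

/-- The orbit of `e_p + e_{p+1}` has dimension at least `p + q - 1`. -/
theorem le_orbitDim_posVec (h : q ≤ p) (hq : 0 < q) (K : Subgroup (GLpq p q)) :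
    p + q ≤ orbitDim (groupKAN h K) (posVec h ⟨0, hq⟩) + 1 := by
  set i : Fin q := ⟨0, hq⟩ with hi
  have hcard : Module.finrank ℝ (Vec p q) = p + q := by simp
  have hf : nullV h i ≠ 0 := fun h0 => by
    have h1 := nullV_negVec h i i
    rw [h0, if_pos rfl] at h1
    norm_num at h1
  rw [← hcard, ← Module.Dual.finrank_ker_add_one_of_ne_zero hf, orbitDim]
  refine Nat.add_le_add_right (Submodule.finrank_mono fun y hy => ?_) 1
  rw [LinearMap.mem_ker] at hy
  -- `y` is the sum of a multiple of `e_p + e_{p+1}`, reached by `𝔞`, and of a vector `z` with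
  -- `u_i z = v_i z = 0`, reached by `𝔫`; the factor `1/2` compensates `u_i (e_p + e_{p+1}) = 2`.
  have hle : ∀ j ≤ i, j = i := fun j hj => le_antisymm hj (Nat.zero_le _)
  set z : Vec p q := y - (nullU h i y / 2) • posVec h i with hz
  have hw : wedge ((1 / 2 : ℝ) • z) (negVec h i) ∈ nilpotentPart h := by
    refine wedge_negVec_mem_nilpotentPart h (fun j hj => ?_) fun j hj => ?_
    · rw [hle j hj]
      simp [hz, nullU_posVec]
    · rw [hle j hj]
      simp [hz, hy, nullV_posVec]
  have hA : cartanElt h (Pi.single i (nullU h i y / 2)) ∈ lieAlg (groupKAN h K) := fun t =>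
    ⟨expGL (cartanElt h (t • Pi.single i (nullU h i y / 2))),
      (le_sup_of_le_left le_sup_right : groupA h ≤ groupKAN h K) (expGL_mem_groupA h _), by
        rw [smul_cartanElt, coe_expGL]⟩
  have hN : wedge ((1 / 2 : ℝ) • z) (negVec h i) ∈ lieAlg (groupKAN h K) := fun t =>
    ⟨expGL (t • wedge ((1 / 2 : ℝ) • z) (negVec h i)),
      groupN_le_groupKAN h K (expGL_mem_groupN (Submodule.smul_mem _ t hw)), rfl⟩
  have hsum : y = cartanElt h (Pi.single i (nullU h i y / 2)) *ᵥ posVec h i +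
      wedge ((1 / 2 : ℝ) • z) (negVec h i) *ᵥ posVec h i := by
    rw [cartanElt_mulVec_posVec, wedge_mulVec, scalarProd_negVec, nullU_posVec, if_pos rfl,
      scalarProd_comm, scalarProd_posVec, map_smul, hz, map_sub, map_smul, hy, nullV_posVec,
      Pi.single_eq_same]
    module
  rw [hsum]
  exact add_mem (Submodule.subset_span ⟨_, hA, rfl⟩) (Submodule.subset_span ⟨_, hN, rfl⟩)

theorem isCohomogeneityOne_groupKAN (h : q ≤ p) (hq : 0 < q) {K : Subgroup (GLpq p q)}
    (hK : K ≤ groupK₀ p q) : IsCohomogeneityOne (groupKAN h K) := by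
  have hle := orbitDim_add_one_le (isIsometricAction_groupKAN h hK) (hq.trans_le h)
  exact ⟨⟨posVec h ⟨0, hq⟩, le_antisymm (hle _) (le_orbitDim_posVec h hq K)⟩, hle⟩

/-! ### Comparison of the orbits -/

/-- Off `W^p`, a Siegel transvection can undo any rotation in `K₀`. -/
theorem exists_mem_groupN_mulVec_eq (h : q ≤ p) {x : Vec p q} (hx : x ∉ degSubspace h)
    {k : GLpq p q} (hk : k ∈ groupK₀ p q) :
    ∃ m ∈ groupN h, (m : Mat p q) *ᵥ x = (k : Mat p q) *ᵥ x := by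
  obtain ⟨i, hi⟩ : ∃ i, nullU h i x ≠ 0 := by
    rw [mem_degSubspace_iff] at hx
    push Not at hx
    exact hx
  have hmid : midPart p q ((k : Mat p q) *ᵥ x - x) = (k : Mat p q) *ᵥ x - x := by
    refine vec_ext h (fun j => ?_) (fun j => ?_) (midPart_midPart _)
    · rw [nullU_midPart, map_sub, nullU_mulVec_of_mem_groupK₀ h hk, sub_self]
    · rw [nullV_midPart, map_sub, nullV_mulVec_of_mem_groupK₀ h hk, sub_self]
  set z := midPart p q ((nullU h i x)⁻¹ • ((k : Mat p q) *ᵥ x - x)) with hz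
  have hw : wedge z (negVec h i) ∈ nilpotentPart h :=
    wedge_midPart_negVec_mem_nilpotentPart h i _
  obtain ⟨t, ht⟩ := exists_exp_wedge_mulVec h (i := i) (z := z) (nullU_midPart h i _) x
  have ht' : NormedSpace.exp (wedge z (negVec h i)) *ᵥ x =
      (k : Mat p q) *ᵥ x + t • negVec h i := by
    rw [ht, hz, map_smul, hmid, smul_smul, mul_inv_cancel₀ hi, one_smul, add_sub_cancel]
  -- Both sides have the same scalar square, and `⟨k x, e⟩ ≠ 0` for the null vector `e`.
  have hiso := (IsTriangular.exp_of_mem_nilpotentPart hw).isometric x x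
  rw [ht', ← scalarProd_mulVec_of_mem_groupK₀ hk x x] at hiso
  simp only [scalarProd_add_right, scalarProd_smul_right, scalarProd_negVec, map_add, map_smul,
    smul_eq_mul, nullU_negVec, nullU_mulVec_of_mem_groupK₀ h hk, scalarProd_add_left,
    scalarProd_smul_left, scalarProd_comm (negVec h i)] at hiso
  have ht0 : t = 0 := (mul_eq_zero.1 (by linarith : t * nullU h i x = 0)).resolve_right hi
  refine ⟨expGL (wedge z (negVec h i)), expGL_mem_groupN hw, ?_⟩
  rw [coe_expGL, ht', ht0, zero_smul, add_zero]

theorem orbitOf_groupKAN_subset_of_notMem (h : q ≤ p) {K₁ K₂ : Subgroup (GLpq p q)}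
    (hK₁ : K₁ ≤ groupK₀ p q) {x : Vec p q} (hx : x ∉ degSubspace h) :
    orbitOf (groupKAN h K₁) x ⊆ orbitOf (groupKAN h K₂) x := by
  rintro _ ⟨g, hg, rfl⟩
  obtain ⟨b, hb, k, hk, rfl⟩ := exists_eq_mul_of_mem_groupKAN h hK₁ hg
  obtain ⟨m, hm, hmx⟩ := exists_mem_groupN_mulVec_eq h hx (hK₁ hk)
  refine ⟨b * m, mul_mem (groupKAN_mono h bot_le hb) (groupN_le_groupKAN h K₂ hm), ?_⟩
  rw [Units.val_mul, Units.val_mul, ← Matrix.mulVec_mulVec, ← Matrix.mulVec_mulVec, hmx]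

theorem orbitOf_groupKAN_eq_of_notMem (h : q ≤ p) {K₁ K₂ : Subgroup (GLpq p q)}
    (hK₁ : K₁ ≤ groupK₀ p q) (hK₂ : K₂ ≤ groupK₀ p q) {x : Vec p q} (hx : x ∉ degSubspace h) :
    orbitOf (groupKAN h K₁) x = orbitOf (groupKAN h K₂) x :=
  (orbitOf_groupKAN_subset_of_notMem h hK₁ hx).antisymm
    (orbitOf_groupKAN_subset_of_notMem h hK₂ hx)

theorem orbitOf_groupKAN_subset_of_orbitOf_eq (h : q ≤ p) {K₁ K₂ : Subgroup (GLpq p q)}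
    (hK₁ : K₁ ≤ groupK₀ p q) {x : Vec p q} (hx : orbitOf K₁ x = orbitOf K₂ x) :
    orbitOf (groupKAN h K₁) x ⊆ orbitOf (groupKAN h K₂) x := by
  rintro _ ⟨g, hg, rfl⟩
  obtain ⟨b, hb, k, hk, rfl⟩ := exists_eq_mul_of_mem_groupKAN h hK₁ hg
  have hkx : (k : Mat p q) *ᵥ x ∈ orbitOf K₂ x := hx ▸ ⟨k, hk, rfl⟩
  obtain ⟨k', hk', hkk'⟩ := hkx
  refine ⟨b * k', mul_mem (groupKAN_mono h bot_le hb) (le_groupKAN h K₂ hk'), ?_⟩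
  rw [Units.val_mul, Units.val_mul, ← Matrix.mulVec_mulVec, ← Matrix.mulVec_mulVec, hkk']

/-- The orbits in `W^p` determine those of the compact factor, since on the quotient of `W^p` by
its radical only that factor acts nontrivially. -/
theorem orbitOf_subset_of_orbitOf_groupKAN_eq (h : q ≤ p) {K₁ K₂ : Subgroup (GLpq p q)}
    (hK₁ : K₁ ≤ groupK₀ p q) (hK₂ : K₂ ≤ groupK₀ p q) {x : Vec p q}
    (hx : orbitOf (groupKAN h K₁) (midPart p q x) = orbitOf (groupKAN h K₂) (midPart p q x)) :
    orbitOf K₁ x ⊆ orbitOf K₂ x := by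
  rintro _ ⟨k, hk, rfl⟩
  have hkx : (k : Mat p q) *ᵥ midPart p q x ∈ orbitOf (groupKAN h K₂) (midPart p q x) :=
    hx ▸ ⟨k, le_groupKAN h K₁ hk, rfl⟩
  obtain ⟨g, hg, hgx⟩ := hkx
  obtain ⟨k', hk', a, -, hgk⟩ := (mem_groupKAN_iff h hK₂ g).1 hg
  have h1 := congrArg (midPart p q) hgx
  rw [hgk.mid _ (midPart_mem_degSubspace h x), midPart_mulVec_of_mem_groupK₀ h (hK₁ hk),
    midPart_mulVec_of_mem_groupK₀ h (hK₂ hk'), midPart_midPart] at h1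
  have hfix : ∀ b ∈ groupK₀ p q, (b : Mat p q) *ᵥ x =
      (x - midPart p q x) + (b : Mat p q) *ᵥ midPart p q x := fun b hb => by
    rw [← mulVec_eq_self_of_mem_groupK₀ hb (x := x - midPart p q x)
      (by rw [map_sub, midPart_midPart, sub_self]), ← Matrix.mulVec_add, sub_add_cancel]
  exact ⟨k', hk', by rw [hfix k (hK₁ hk), hfix k' (hK₂ hk'), h1]⟩

/-! ### Transitivity of `K₀` on spheres -/

/-- The matrix of the orthogonal reflection in the hyperplane perpendicular to `n ≠ 0`. -/
def householder (n : Vec p q) : Mat p q := 1 - (2 / (n ⬝ᵥ n)) • Matrix.vecMulVec n n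

theorem householder_mulVec (n x : Vec p q) :
    householder n *ᵥ x = x - (2 * (n ⬝ᵥ x) / (n ⬝ᵥ n)) • n := by
  rw [householder, Matrix.sub_mulVec, Matrix.one_mulVec, Matrix.smul_mulVec,
    Matrix.vecMulVec_mulVec, op_smul_eq_smul, smul_smul, div_mul_eq_mul_div]

theorem householder_transpose (n : Vec p q) : (householder n)ᵀ = householder n := by
  rw [householder, Matrix.transpose_sub, Matrix.transpose_one, Matrix.transpose_smul,
    Matrix.transpose_vecMulVec]

theorem householder_mul_self {n : Vec p q} (hn : n ⬝ᵥ n ≠ 0) :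
    householder n * householder n = 1 := by
  refine mat_ext fun x => ?_
  rw [← Matrix.mulVec_mulVec, Matrix.one_mulVec, householder_mulVec, householder_mulVec,
    dotProduct_sub, dotProduct_smul, smul_eq_mul, sub_sub, ← add_smul]
  have h1 : 2 * (n ⬝ᵥ x) / (n ⬝ᵥ n) +
      2 * (n ⬝ᵥ x - 2 * (n ⬝ᵥ x) / (n ⬝ᵥ n) * (n ⬝ᵥ n)) / (n ⬝ᵥ n) = 0 := by
    field_simp
    ring
  rw [h1, zero_smul, sub_zero]

theorem det_householder {n : Vec p q} (hn : n ⬝ᵥ n ≠ 0) : (householder n).det = -1 := by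
  have h1 : householder n = 1 + Matrix.replicateCol Unit (-(2 / (n ⬝ᵥ n)) • n) *
      Matrix.replicateRow Unit n := by
    rw [← Matrix.vecMulVec_eq, Matrix.smul_vecMulVec, neg_smul, ← sub_eq_add_neg, householder]
  rw [h1, Matrix.det_one_add_replicateCol_mul_replicateRow, dotProduct_smul, smul_eq_mul]
  field_simp
  ring

/-- The product of two reflections in hyperplanes whose normals have no components off
`e_1, …, e_{p-q}` belongs to `K₀`. -/
theorem exists_mem_groupK₀_eq_householder_mul {n n' : Vec p q} (hn : n ⬝ᵥ n ≠ 0)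
    (hn' : n' ⬝ᵥ n' ≠ 0) (hm : midPart p q n = n) (hm' : midPart p q n' = n') :
    ∃ k ∈ groupK₀ p q, (k : Mat p q) = householder n * householder n' := by
  have horth : householder n * householder n' * (householder n' * householder n) = 1 := by
    rw [mul_assoc, ← mul_assoc (householder n'), householder_mul_self hn', one_mul,
      householder_mul_self hn]
  have horth' : householder n' * householder n * (householder n * householder n') = 1 := by
    rw [mul_assoc, ← mul_assoc (householder n), householder_mul_self hn, one_mul,
      householder_mul_self hn']
  have hstar : star (householder n * householder n') = householder n' * householder n := by
    rw [Matrix.star_eq_conjTranspose, Matrix.conjTranspose_eq_transpose_of_trivial,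
      Matrix.transpose_mul, householder_transpose, householder_transpose]
  have hfix : ∀ (v : Vec p q) (j : Fin p ⊕ Fin q),
      v j = 0 → householder v *ᵥ Pi.single j 1 = Pi.single j 1 := by
    intro v j hj
    rw [householder_mulVec, dotProduct_single_one, hj, mul_zero, zero_div, zero_smul, sub_zero]
  have hl : ∀ v : Vec p q, midPart p q v = v → ∀ k : Fin p, p - q ≤ (k : ℕ) →
      v (Sum.inl k) = 0 := fun v hv k hk => by
    rw [← hv, midPart_inl, if_neg (not_lt.2 hk)]
  have hr : ∀ v : Vec p q, midPart p q v = v → ∀ j : Fin q, v (Sum.inr j) = 0 := fun v hv j => by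
    rw [← hv, midPart_inr]
  refine ⟨⟨householder n * householder n', householder n' * householder n, horth, horth'⟩,
    ⟨?_, fun k hk => ?_, fun j => ?_⟩, rfl⟩
  · rw [Matrix.mem_specialOrthogonalGroup_iff]
    refine ⟨⟨?_, ?_⟩, ?_⟩
    · rw [hstar]
      exact horth'
    · rw [hstar]
      exact horth
    · rw [Matrix.det_mul, det_householder hn, det_householder hn']
      norm_num
  · rw [← Matrix.mulVec_mulVec, hfix n' _ (hl n' hm' k hk), hfix n _ (hl n hm k hk)]
  · rw [← Matrix.mulVec_mulVec, hfix n' _ (hr n' hm' j), hfix n _ (hr n hm j)]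

/-- If `p - q ≥ 2`, then some nonzero vector of the middle space is orthogonal to a given one. -/
theorem exists_orthogonal_midPart (hpq : q + 1 < p) (y : Vec p q) :
    ∃ n : Vec p q, midPart p q n = n ∧ n ⬝ᵥ n ≠ 0 ∧ n ⬝ᵥ y = 0 := by
  let i₀ : Fin p := ⟨0, by omega⟩
  let i₁ : Fin p := ⟨1, by omega⟩
  have hi : i₀ ≠ i₁ := by simp [i₀, i₁]
  have hmid : ∀ a b : ℝ, midPart p q (Pi.single (Sum.inl i₀) a + Pi.single (Sum.inl i₁) b) =
      Pi.single (Sum.inl i₀) a + Pi.single (Sum.inl i₁) b := by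
    intro a b
    ext (k | k)
    · rw [midPart_inl]
      split_ifs with hk
      · rfl
      · have h0 : k ≠ i₀ := fun e => hk (by rw [e]; simp only [i₀]; omega)
        have h1 : k ≠ i₁ := fun e => hk (by rw [e]; simp only [i₁]; omega)
        simp [h0, h1]
    · simp [midPart_inr]
  by_cases hy : y (Sum.inl i₀) = 0
  · refine ⟨Pi.single (Sum.inl i₀) 1 + Pi.single (Sum.inl i₁) 0, hmid 1 0, ?_, ?_⟩
    · simp
    · simp [hy]
  · refine ⟨Pi.single (Sum.inl i₀) (y (Sum.inl i₁)) + Pi.single (Sum.inl i₁) (-y (Sum.inl i₀)),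
      hmid _ _, ?_, ?_⟩
    · simp only [add_dotProduct, single_dotProduct, Pi.add_apply, Pi.single_apply, Sum.inl.injEq,
        hi, hi.symm, if_true, if_false, add_zero, zero_add]
      have := mul_self_pos.2 hy
      nlinarith [mul_self_nonneg (y (Sum.inl i₁))]
    · simp only [add_dotProduct, single_dotProduct]
      ring

theorem exists_mem_groupK₀_mulVec_eq (hpq : q + 1 < p) {x y : Vec p q}
    (hx : midPart p q x = x) (hy : midPart p q y = y) (hxy : x ⬝ᵥ x = y ⬝ᵥ y) :
    ∃ k ∈ groupK₀ p q, (k : Mat p q) *ᵥ x = y := by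
  by_cases hne : x = y
  · exact ⟨1, one_mem _, by rw [Units.val_one, Matrix.one_mulVec, hne]⟩
  obtain ⟨n, hn, hnn, hny⟩ := exists_orthogonal_midPart hpq y
  have hsub : (x - y) ⬝ᵥ (x - y) ≠ 0 := fun h0 =>
    hne (sub_eq_zero.1 (dotProduct_self_eq_zero.1 h0))
  -- The reflection along `x - y` maps `x` to `y`, and the one along `n` fixes `y`.
  obtain ⟨k, hk, hkeq⟩ := exists_mem_groupK₀_eq_householder_mul hnn hsub hn
    (by rw [map_sub, hx, hy])
  refine ⟨k, hk, ?_⟩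
  have h1 : 2 * ((x - y) ⬝ᵥ x) / ((x - y) ⬝ᵥ (x - y)) = 1 := by
    rw [div_eq_one_iff_eq hsub]
    simp only [sub_dotProduct, dotProduct_sub, hxy, dotProduct_comm y x]
    ring
  rw [hkeq, ← Matrix.mulVec_mulVec, householder_mulVec (x - y), h1, one_smul, sub_sub_cancel,
    householder_mulVec, hny, mul_zero, zero_div, zero_smul, sub_zero]

/-! ### Orbits of `AN` and `K₀AN` in `W^p` -/

theorem midPart_mulVec_of_mem_groupKAN_bot (h : q ≤ p) {g : GLpq p q} (hg : g ∈ groupKAN h ⊥)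
    {x : Vec p q} (hx : x ∈ degSubspace h) :
    midPart p q ((g : Mat p q) *ᵥ x) = midPart p q x := by
  obtain ⟨k, hk, a, -, hgk⟩ := (mem_groupKAN_iff h bot_le g).1 hg
  rw [hgk.mid x hx, Subgroup.mem_bot.1 hk, Units.val_one, Matrix.one_mulVec]

theorem scalarProd_midPart (x y : Vec p q) :
    scalarProd x (midPart p q y) = midPart p q x ⬝ᵥ midPart p q y := by
  simp only [scalarProd, dotProduct, Fintype.sum_sum_type, midPart_inl, midPart_inr, mul_zero,
    Finset.sum_const_zero, sub_zero, add_zero]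
  exact Finset.sum_congr rfl fun k _ => by split_ifs <;> simp

/-- At points of `W^p` outside the radical, `N` acts transitively on the translates of the
radical. -/
theorem exists_mem_groupN_mulVec_eq_add (h : q ≤ p) {x : Vec p q} (hx : x ∈ degSubspace h)
    (hm : midPart p q x ≠ 0) (c : Fin q → ℝ) (s : Finset (Fin q)) :
    ∃ m ∈ groupN h, (m : Mat p q) *ᵥ x = x + ∑ i ∈ s, c i • negVec h i := by
  have hmm : midPart p q x ⬝ᵥ midPart p q x ≠ 0 := fun h0 => hm (dotProduct_self_eq_zero.1 h0)
  induction s using Finset.induction_on with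
  | empty => exact ⟨1, one_mem _, by simp⟩
  | insert i s hi ih =>
    obtain ⟨m, hmN, hmx⟩ := ih
    set z := midPart p q (-(c i / (midPart p q x ⬝ᵥ midPart p q x)) • x) with hz
    refine ⟨expGL (wedge z (negVec h i)) * m,
      mul_mem (expGL_mem_groupN (wedge_midPart_negVec_mem_nilpotentPart h i _)) hmN, ?_⟩
    have hU : nullU h i (x + ∑ j ∈ s, c j • negVec h j) = 0 := by
      simp [(mem_degSubspace_iff h x).1 hx i, nullU_negVec]
    have hprod : scalarProd (x + ∑ j ∈ s, c j • negVec h j) z = -c i := by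
      rw [hz, scalarProd_midPart, map_add, map_sum]
      simp only [map_smul, midPart_negVec, smul_zero, Finset.sum_const_zero, add_zero,
        dotProduct_smul, smul_eq_mul]
      field_simp
    rw [Units.val_mul, ← Matrix.mulVec_mulVec, hmx, coe_expGL,
      exp_wedge_mulVec_of_nullU_eq_zero h (nullU_midPart h i _) hU, hprod,
      Finset.sum_insert hi, neg_smul, sub_neg_eq_add]
    abel

/-- Outside the radical of `W^p`, the orbits of `K₀AN` in `W^p` are the products of the radical and
the spheres in the middle space. -/
theorem mem_orbitOf_groupKAN_groupK₀_iff (h : q ≤ p) (hpq : q + 1 < p) {x y : Vec p q}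
    (hx : x ∈ degSubspace h) (hy : y ∈ degSubspace h) (hm : midPart p q x ≠ 0) :
    y ∈ orbitOf (groupKAN h (groupK₀ p q)) x ↔
      midPart p q y ⬝ᵥ midPart p q y = midPart p q x ⬝ᵥ midPart p q x := by
  constructor
  · rintro ⟨g, hg, rfl⟩
    obtain ⟨k, hk, a, -, hgk⟩ := (mem_groupKAN_iff h le_rfl g).1 hg
    rw [hgk.mid x hx, midPart_mulVec_of_mem_groupK₀ h hk, dotProduct_mulVec_of_mem_groupK₀ hk]
  · intro hxy
    obtain ⟨k, hk, hkx⟩ := exists_mem_groupK₀_mulVec_eq hpq (midPart_midPart x) (midPart_midPart y)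
      hxy.symm
    have hmk : midPart p q ((k : Mat p q) *ᵥ x) = midPart p q y := by
      rw [midPart_mulVec_of_mem_groupK₀ h hk, hkx]
    have hkW : (k : Mat p q) *ᵥ x ∈ degSubspace h :=
      (IsTriangular.of_mem_groupK₀ h hk).mulVec_mem hx
    have hne : midPart p q ((k : Mat p q) *ᵥ x) ≠ 0 := fun h0 => hm (by
      rw [hmk] at h0
      rw [h0, zero_dotProduct] at hxy
      exact dotProduct_self_eq_zero.1 hxy.symm)
    obtain ⟨m, hmN, hmx⟩ := exists_mem_groupN_mulVec_eq_add h hkW hne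
      (fun i => nullV h i (y - (k : Mat p q) *ᵥ x) / 2) Finset.univ
    refine ⟨m * k, mul_mem (groupN_le_groupKAN h _ hmN) (le_groupKAN h _ hk), ?_⟩
    rw [Units.val_mul, ← Matrix.mulVec_mulVec, hmx]
    refine vec_ext h (fun i => ?_) (fun i => ?_) ?_
    · simp [(mem_degSubspace_iff h _).1 hy, (mem_degSubspace_iff h _).1 hkW, nullU_negVec]
    · simp [nullV_negVec]
    · simp [hmk, midPart_negVec]

/-! ### Orbits in `W^p` up to homeomorphism -/

/-- Removing a part of a translate of a subspace of codimension at least two from a real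
topological vector space leaves a connected set. -/
theorem isPreconnected_compl_of_subset_translate {E : Type*} [AddCommGroup E] [Module ℝ E]
    [TopologicalSpace E] [IsTopologicalAddGroup E] [ContinuousSMul ℝ E] {S : Submodule ℝ E}
    (hS : 1 < Module.rank ℝ (E ⧸ S)) {O : Set E} {v : E} (hO : ∀ x ∈ O, x - v ∈ S) :
    IsPreconnected Oᶜ := by
  have hconn : IsPreconnected {x : E | x - v ∉ S} := by
    have h1 := (isConnected_compl_of_one_lt_codim hS).isPreconnected.image (Homeomorph.addRight v)
      (Homeomorph.addRight v).continuous.continuousOn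
    convert h1 using 1
    ext x
    simp only [Homeomorph.coe_addRight, Set.mem_image, Set.mem_compl_iff, SetLike.mem_coe]
    exact ⟨fun hx => ⟨x - v, hx, sub_add_cancel x v⟩, by rintro ⟨y, hy, rfl⟩; simpa using hy⟩
  have hne : S ≠ ⊤ := by
    rintro rfl
    have := rank_subsingleton' (R := ℝ) (M := E ⧸ (⊤ : Submodule ℝ E))
    rw [this] at hS
    exact absurd hS (by simp)
  have hdense : Dense {x : E | x - v ∉ S} := by
    have h1 : Dense ((S : Set E)ᶜ) := by
      rw [← interior_eq_empty_iff_dense_compl]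
      by_contra h0
      exact hne (S.eq_top_of_nonempty_interior' (Set.nonempty_iff_ne_empty.2 h0))
    exact h1.preimage (Homeomorph.addRight (-v)).isOpenMap |>.mono fun x hx => by
      simpa [sub_eq_add_neg] using hx
  refine hconn.subset_closure (fun x hx hxO => hx (hO x hxO)) ?_
  rw [hdense.closure_eq]
  exact Set.subset_univ _

theorem one_lt_rank_quotient_ker_midPart (h : q ≤ p) (hpq : q + 1 < p) :
    1 < Module.rank ℝ (degSubspace h ⧸
      LinearMap.ker ((midPart p q).comp (degSubspace h).subtype)) := by
  let i₀ : Fin p := ⟨0, by omega⟩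
  let i₁ : Fin p := ⟨1, by omega⟩
  have hi₀ : (i₀ : ℕ) < p - q := by simp only [i₀]; omega
  have hi₁ : (i₁ : ℕ) < p - q := by simp only [i₁]; omega
  have hne : i₁ ≠ i₀ := by simp [i₀, i₁]
  let φ : degSubspace h →ₗ[ℝ] (Fin 2 → ℝ) := LinearMap.pi fun r =>
    (LinearMap.proj (Sum.inl (if r = 0 then i₀ else i₁)) : Vec p q →ₗ[ℝ] ℝ).comp
      (degSubspace h).subtype
  have hle : LinearMap.ker ((midPart p q).comp (degSubspace h).subtype) ≤ LinearMap.ker φ := by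
    intro x hx
    have h1 := midPart_eq_zero_iff.1 (LinearMap.mem_ker.1 hx)
    rw [LinearMap.mem_ker]
    ext r
    refine h1 _ ?_
    split_ifs
    exacts [hi₀, hi₁]
  have hsurj : Function.Surjective (Submodule.liftQ _ φ hle) := by
    intro c
    refine ⟨Submodule.Quotient.mk ⟨midPart p q (Pi.single (Sum.inl i₀) (c 0) +
      Pi.single (Sum.inl i₁) (c 1)), midPart_mem_degSubspace h _⟩, ?_⟩
    rw [Submodule.liftQ_apply]
    ext r
    fin_cases r
    · simp [φ, midPart_inl, hi₀, hne.symm]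
    · simp [φ, midPart_inl, hi₁, hne]
  have h1 := LinearMap.rank_le_of_surjective _ hsurj
  rw [rank_fun'] at h1
  refine lt_of_lt_of_le ?_ h1
  simp

/-- The complement in `W^p` of an orbit of `AN` is connected, whereas the orbit of `e_1` under
`K₀AN`, a product of the radical and a sphere, separates `W^p`. -/
theorem not_topOrbitEquivalentOn (h : q ≤ p) (hpq : q + 1 < p) :
    ¬ TopOrbitEquivalentOn (groupKAN h ⊥) (groupKAN h (groupK₀ p q))
      (degSubspace h : Set (Vec p q)) := by
  rintro ⟨f, hf⟩
  let i₀ : Fin p := ⟨0, by omega⟩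
  have hi₀ : (i₀ : ℕ) < p - q := by simp only [i₀]; omega
  have hmid : midPart p q (Pi.single (Sum.inl i₀) 1) = Pi.single (Sum.inl i₀) 1 := by
    ext (k | k)
    · rw [midPart_inl]
      split_ifs with hk
      · rfl
      · have h0 : k ≠ i₀ := fun e => hk (e ▸ hi₀)
        simp [h0]
    · simp [midPart_inr]
  let y : degSubspace h := ⟨midPart p q (Pi.single (Sum.inl i₀) 1), midPart_mem_degSubspace h _⟩
  have hy : midPart p q (y : Vec p q) = Pi.single (Sum.inl i₀) 1 := by
    rw [midPart_midPart, hmid]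
  let y' : degSubspace h := f.symm y
  have hfy : f y' = y := f.apply_symm_apply y
  let N : degSubspace h → ℝ := fun x => midPart p q (x : Vec p q) ⬝ᵥ midPart p q (x : Vec p q)
  have hN : Continuous N := by
    have hM : Continuous (midPart p q) := LinearMap.continuous_of_finiteDimensional _
    exact (hM.comp continuous_subtype_val).dotProduct (hM.comp continuous_subtype_val)
  let O : Set (degSubspace h) := {x | (x : Vec p q) ∈ orbitOf (groupKAN h ⊥) y'}
  have hO : IsPreconnected Oᶜ := by
    refine isPreconnected_compl_of_subset_translate (v := y')
      (one_lt_rank_quotient_ker_midPart h hpq) ?_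
    rintro x ⟨g, hg, hgx⟩
    rw [LinearMap.mem_ker, map_sub, sub_eq_zero]
    change midPart p q (x : Vec p q) = midPart p q (y' : Vec p q)
    rw [hgx, midPart_mulVec_of_mem_groupKAN_bot h hg y'.2]
  have himg : IsPreconnected (N '' (f '' Oᶜ)) :=
    (hO.image f f.continuous.continuousOn).image N hN.continuousOn
  have hmem : ∀ x : degSubspace h, N x ≠ 1 → N x ∈ N '' (f '' Oᶜ) := by
    intro x hx
    refine ⟨x, ⟨f.symm x, fun hxO => hx ?_, f.apply_symm_apply x⟩, rfl⟩
    have h1 := (hf y' (f.symm x)).1 hxO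
    rw [hfy, f.apply_symm_apply, mem_orbitOf_groupKAN_groupK₀_iff h hpq y.2 x.2
      (by rw [hy]; simp), hy] at h1
    simpa using h1
  have h0 : N 0 = 0 := by simp [N]
  have h4 : N ((2 : ℝ) • y) = 4 := by
    simp only [N, Submodule.coe_smul, map_smul, hy]
    simp
    norm_num
  have h0mem := hmem 0 (by rw [h0]; norm_num)
  have h4mem := hmem ((2 : ℝ) • y) (by rw [h4]; norm_num)
  rw [h0] at h0mem
  rw [h4] at h4mem
  obtain ⟨-, ⟨w, hw, rfl⟩, hw1⟩ := himg.ordConnected.out h0mem h4mem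
    (⟨by norm_num, by norm_num⟩ : (1 : ℝ) ∈ Set.Icc 0 4)
  refine hw ?_
  change (w : Vec p q) ∈ orbitOf (groupKAN h ⊥) y'
  rw [hf y' w, hfy, mem_orbitOf_groupKAN_groupK₀_iff h hpq y.2 (f w).2 (by rw [hy]; simp), hy]
  simpa using hw1

theorem OrbitEquivalentOn.topOrbitEquivalentOn {G H : Subgroup (GLpq p q)} {S : Set (Vec p q)}
    (hGH : OrbitEquivalentOn G H S) : TopOrbitEquivalentOn G H S := by
  obtain ⟨f, -, hS, hf⟩ := hGH
  have hiff : ∀ x, x ∈ S ↔ f x ∈ S := fun x => by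
    conv_rhs => rw [← hS]
    exact (f.injective.mem_set_image).symm
  refine ⟨(AffineEquiv.toContinuousAffineEquiv f).toHomeomorph.subtype hiff, fun x y => ?_⟩
  change _ ↔ f y ∈ orbitOf H (f x)
  rw [← hf x x.2, f.injective.mem_set_image]

theorem isClosed_groupK₀ : IsClosed (groupK₀ p q : Set (GLpq p q)) := by
  have hval : Continuous fun g : GLpq p q => (g : Mat p q) := Units.continuous_val
  have h1 : IsClosed {A : Mat p q | A ∈ Matrix.specialOrthogonalGroup (Fin p ⊕ Fin q) ℝ} := by
    simp only [Matrix.mem_specialOrthogonalGroup_iff, Matrix.mem_orthogonalGroup_iff]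
    exact (isClosed_eq (by fun_prop) continuous_const).inter
      (isClosed_eq (by fun_prop) continuous_const)
  have h2 : ∀ x : Vec p q, IsClosed {g : GLpq p q | (g : Mat p q) *ᵥ x = x} := fun x =>
    isClosed_eq (continuous_val_mulVec x) continuous_const
  refine isClosed_of_closure_subset fun g hg => ⟨?_, fun k hk => ?_, fun j => ?_⟩
  · exact closure_minimal (fun k hk => hk.1) (h1.preimage hval) hg
  · exact closure_minimal (fun b hb => hb.2.1 k hk) (h2 _) hg
  · exact closure_minimal (fun b hb => hb.2.2 j) (h2 _) hg

end PseudoEuclid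

end

theorem proposition5p7 (p q : ℕ) (hq : 1 ≤ q) (hpq : q + 1 < p) (h : q ≤ p) :
    -- `W^p` is a degenerate subspace of dimension `p`
    Module.finrank ℝ (PseudoEuclid.degSubspace h) = p ∧
    (∃ v ∈ PseudoEuclid.degSubspace h, v ≠ 0 ∧
      ∀ w ∈ PseudoEuclid.degSubspace h, PseudoEuclid.scalarProd v w = 0) ∧
    -- the actions of the groups `K'AN` are isometric and of cohomogeneity one
    (∀ K : Subgroup (PseudoEuclid.GLpq p q), K ≤ PseudoEuclid.groupK₀ p q →
      PseudoEuclid.IsIsometricAction (PseudoEuclid.groupKAN h K) ∧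
      PseudoEuclid.IsCohomogeneityOne (PseudoEuclid.groupKAN h K) ∧
      (IsClosed (K : Set (PseudoEuclid.GLpq p q)) →
        IsClosed (PseudoEuclid.groupKAN h K : Set (PseudoEuclid.GLpq p q))) ∧
      -- the orbits of points of `W^p` stay in `W^p`
      ∀ x ∈ PseudoEuclid.degSubspace h,
        PseudoEuclid.orbitOf (PseudoEuclid.groupKAN h K) x ⊆ PseudoEuclid.degSubspace h) ∧
    -- off `W^p` they have the same orbits, whatever `K'` is; on `W^p` they have the same orbits
    -- exactly when the subgroups `K'` have the same orbits
    (∀ K₁ K₂ : Subgroup (PseudoEuclid.GLpq p q),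
      K₁ ≤ PseudoEuclid.groupK₀ p q → K₂ ≤ PseudoEuclid.groupK₀ p q →
      (∀ x ∉ PseudoEuclid.degSubspace h,
        PseudoEuclid.orbitOf (PseudoEuclid.groupKAN h K₁) x =
          PseudoEuclid.orbitOf (PseudoEuclid.groupKAN h K₂) x) ∧
      PseudoEuclid.OrbitEquivalentOn (PseudoEuclid.groupKAN h K₁) (PseudoEuclid.groupKAN h K₂)
        (PseudoEuclid.degSubspace h : Set (PseudoEuclid.Vec p q))ᶜ ∧
      ((∀ x ∈ PseudoEuclid.degSubspace h,
        PseudoEuclid.orbitOf (PseudoEuclid.groupKAN h K₁) x =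
          PseudoEuclid.orbitOf (PseudoEuclid.groupKAN h K₂) x) ↔
        ∀ x : PseudoEuclid.Vec p q, PseudoEuclid.orbitOf K₁ x = PseudoEuclid.orbitOf K₂ x)) ∧
    -- some of them are not orbit-equivalent on `W^p`, not even by a homeomorphism of `W^p`
    ∃ K₁ K₂ : Subgroup (PseudoEuclid.GLpq p q),
      K₁ ≤ PseudoEuclid.groupK₀ p q ∧ K₂ ≤ PseudoEuclid.groupK₀ p q ∧
      IsClosed (K₁ : Set (PseudoEuclid.GLpq p q)) ∧
      IsClosed (K₂ : Set (PseudoEuclid.GLpq p q)) ∧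
      ¬ PseudoEuclid.OrbitEquivalentOn (PseudoEuclid.groupKAN h K₁) (PseudoEuclid.groupKAN h K₂)
        (PseudoEuclid.degSubspace h : Set (PseudoEuclid.Vec p q)) ∧
      ¬ PseudoEuclid.TopOrbitEquivalentOn (PseudoEuclid.groupKAN h K₁)
        (PseudoEuclid.groupKAN h K₂) (PseudoEuclid.degSubspace h : Set (PseudoEuclid.Vec p q)) := by
  refine ⟨PseudoEuclid.finrank_degSubspace h, ⟨PseudoEuclid.negVec h ⟨0, hq⟩,
    PseudoEuclid.negVec_mem_degSubspace h _, fun h0 => ?_, fun w hw => ?_⟩, fun K hK => ?_,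
    fun K₁ K₂ hK₁ hK₂ => ⟨fun x hx => ?_, ?_, fun hall x => ?_, fun hall x _ => ?_⟩,
    ⊥, PseudoEuclid.groupK₀ p q, bot_le, le_rfl, ?_, PseudoEuclid.isClosed_groupK₀, ?_, ?_⟩
  · have h1 := PseudoEuclid.nullV_negVec h ⟨0, hq⟩ ⟨0, hq⟩
    rw [h0, map_zero, if_pos rfl] at h1
    norm_num at h1
  · rw [PseudoEuclid.scalarProd_comm, PseudoEuclid.scalarProd_negVec]
    exact (PseudoEuclid.mem_degSubspace_iff h w).1 hw _
  · exact ⟨PseudoEuclid.isIsometricAction_groupKAN h hK,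
      PseudoEuclid.isCohomogeneityOne_groupKAN h hq hK,
      PseudoEuclid.isClosed_groupKAN h hK,
      fun x hx => PseudoEuclid.orbitOf_groupKAN_subset h hK hx⟩
  · exact PseudoEuclid.orbitOf_groupKAN_eq_of_notMem h hK₁ hK₂ hx
  · refine ⟨AffineEquiv.refl ℝ _, fun x y => rfl, Set.image_id _, fun x hx => ?_⟩
    exact (Set.image_id _).trans (PseudoEuclid.orbitOf_groupKAN_eq_of_notMem h hK₁ hK₂ hx)
  · have hx := hall _ (PseudoEuclid.midPart_mem_degSubspace h x)
    exact (PseudoEuclid.orbitOf_subset_of_orbitOf_groupKAN_eq h hK₁ hK₂ hx).antisymm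
      (PseudoEuclid.orbitOf_subset_of_orbitOf_groupKAN_eq h hK₂ hK₁ hx.symm)
  · exact (PseudoEuclid.orbitOf_groupKAN_subset_of_orbitOf_eq h hK₁ (hall x)).antisymm
      (PseudoEuclid.orbitOf_groupKAN_subset_of_orbitOf_eq h hK₂ (hall x).symm)
  · rw [Subgroup.coe_bot]
    exact isClosed_singleton
  · exact fun hequiv => PseudoEuclid.not_topOrbitEquivalentOn h hpq hequiv.topOrbitEquivalentOn
  · exact PseudoEuclid.not_topOrbitEquivalentOn h hpq
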